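/- Let $m \ge 0$ be an integer, let $\mathfrak{h}$ be the Cartan subalgebra of diagonal matrices in $\mathfrak{sl}_m(\mathbb{C})$, let $e_i \in \mathfrak{h}^*$ send a diagonal matrix to its $i$-th diagonal entry, and let $\Lambda \subset \mathfrak{h}^*$ be the integral weight lattice. For $\lambda \in \Lambda$, let $\mathrm{M}(\lambda)$ be the Verma module of highest weight $\lambda$ with respect to the upper triangular Borel subalgebra, that is, the quotient of $U(\mathfrak{sl}_m(\mathbb{C}))$ by the left ideal generated by the strictly upper triangular matrices and the elements $h-\lambda(h)$, $h \in \mathfrak{h}$. Write $\mathrm{M}(\lambda)_\mu$ for its weight spaces, and define the shifted character \[ \underline{\mathrm{ch}}_\lambda(x_1,\ldots,x_m)=\sum_{\mu \in \Lambda} \dim \mathrm{M}(\lambda)_\mu \, x^{\mu-\lambda}, \] where, for $\nu \in \mathbb{Z}^m$ with $\sum_i \nu_i = 0$, the weight $\sum_i \nu_i e_i$ is identified with the exponent vector $\nu$. For a Laurent generating function, set \[ \mathrm{N}\Big(\sum_{\alpha \in \mathbb{Z}^m} c_\alpha x^\alpha\Big)=\sum_{\alpha \in \mathbb{N}^m}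 c_\alpha \frac{x^\alpha}{\alpha_1!\cdots\alpha_m!}. \] A real polynomial $h$ in $m$ variables, homogeneous of degree $d$, is Lorentzian if its coefficients are nonnegative, its support $\mathrm{J} \subseteq \mathbb{N}^m$ is $\mathrm{M}$-convex (for all $\alpha,\beta \in \mathrm{J}$ and $i$ with $\alpha_i > \beta_i$ there is $j$ with $\alpha_j<\beta_j$ such that $\alpha-\epsilon_i+\epsilon_j \in \mathrm{J}$ and $\beta-\epsilon_j+\epsilon_i \in \mathrm{J}$, where $\epsilon_i$ are the standard basis vectors), and, if $d\ge 2$, every partial derivative of $h$ of order $d-2$ is a quadratic form with at most one positive eigenvalue. Then, for every $\lambda \in \Lambda$: \begin{enumerate} \item for every $\mu \in \Lambda$, the weight space $\mathrm{M}(\lambda)_\mu$ is finite-dimensional, and it is zero unless $\mu-\lambda = \sum_i \nu_i e_i$ for some $\nu \in \mathbb{Z}^m$ with $\sum_i \nu_i=0$; \item $\underline{\mathrm{ch}}_\lambda=\prod_{i>j}(1+x_ix_j^{-1}+x_i^2x_j^{-2}+\cdots)$, that is, the coefficient of $x^\nu$ in $\underline{\mathrm{ch}}_\lambda$ is the number of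 families $(k_{ij})_{i>j}$ of nonnegative integers with $\sum_{i>j} k_{ij}(\epsilon_i-\epsilon_j)=\nu$; \item for every $\delta \in \mathbb{N}^m$, $\mathrm{N}(x^\delta\, \underline{\mathrm{ch}}_\lambda)$ is a polynomial, and it is Lorentzian. \end{enumerate} -/

import Mathlib

open MvPolynomial

noncomputable section

namespace VermaLorentzian

/-! ### Lorentzian polynomials -/

/-- A set `J` of integral vectors is `M`-convex: for any index `i` and `α, β ∈ J` with `α i > β i`,
there is an index `j` with `α j < β j`, `α - e_i + e_j ∈ J` and `β - e_j + e_i ∈ J`. -/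
def MConvex {σ : Type*} [DecidableEq σ] (J : Set (σ → ℤ)) : Prop :=
  ∀ (i : σ), ∀ α ∈ J, ∀ β ∈ J, β i < α i →
    ∃ j : σ, α j < β j ∧
      α - Pi.single i 1 + Pi.single j 1 ∈ J ∧ β - Pi.single j 1 + Pi.single i 1 ∈ J

/-- The set of exponents of the monomials appearing in `h`, as a set of integral vectors. -/
def expSupport {σ : Type*} (h : MvPolynomial σ ℝ) : Set (σ → ℤ) :=
  {α | ∃ a ∈ h.support, ∀ i, α i = (a i : ℤ)}

/-- The iterated partial derivative `∂/∂x_{i₁} ⋯ ∂/∂x_{iₖ} h` for the list `[i₁, …, iₖ]`. -/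
def iterPDeriv {σ : Type*} (s : List σ) (h : MvPolynomial σ ℝ) : MvPolynomial σ ℝ :=
  s.foldr (fun i q => pderiv i q) h

/-- The matrix of second partial derivatives at the origin. When `q` is a quadratic form this is
the (constant) Hessian matrix of `q`, that is, twice the symmetric matrix of `q`. -/
def hessian {σ : Type*} (q : MvPolynomial σ ℝ) : Matrix σ σ ℝ :=
  Matrix.of fun i j => constantCoeff (pderiv i (pderiv j q))

theorem pderiv_pderiv_swap {σ : Type*} (i j : σ) (q : MvPolynomial σ ℝ) :
    pderiv i (pderiv j q) = pderiv j (pderiv i q) := by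
  classical
  have h : ⁅(pderiv i : Derivation ℝ (MvPolynomial σ ℝ) (MvPolynomial σ ℝ)),
      (pderiv j : Derivation ℝ (MvPolynomial σ ℝ) (MvPolynomial σ ℝ))⁆ = 0 := by
    refine MvPolynomial.derivation_ext (R := ℝ) fun k => ?_
    rw [Derivation.commutator_apply, pderiv_X, pderiv_X]
    simp only [Pi.single_apply]
    split_ifs <;> simp
  have h2 := congrArg (fun D : Derivation ℝ (MvPolynomial σ ℝ) (MvPolynomial σ ℝ) => D q) h
  simp only [Derivation.commutator_apply, Derivation.zero_apply] at h2
  exact sub_eq_zero.mp h2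

theorem hessian_isHermitian {σ : Type*} (q : MvPolynomial σ ℝ) : (hessian q).IsHermitian := by
  ext i j
  simp only [hessian, Matrix.conjTranspose_apply, Matrix.of_apply, star_trivial]
  rw [pderiv_pderiv_swap]

/-- The quadratic form `q` has at most one positive eigenvalue (counted with multiplicity). -/
def AtMostOnePosEigenvalue {σ : Type*} [Fintype σ] [DecidableEq σ] (q : MvPolynomial σ ℝ) : Prop :=
  (Finset.univ.filter fun i => 0 < (hessian_isHermitian q).eigenvalues i).card ≤ 1

/-- Lorentzian polynomials: homogeneous of some degree `d`, with nonnegative coefficients and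
`M`-convex support, all of whose partial derivatives of order `d - 2` have at most one positive
eigenvalue (no such condition when `d < 2`). -/
def IsLorentzian {σ : Type*} [Fintype σ] [DecidableEq σ] (h : MvPolynomial σ ℝ) : Prop :=
  ∃ d : ℕ, h.IsHomogeneous d ∧
    (∀ a, 0 ≤ h.coeff a) ∧
    MConvex (expSupport h) ∧
    ∀ s : List σ, s.length + 2 = d → AtMostOnePosEigenvalue (iterPDeriv s h)

/-! ### Laurent generating functions -/

/-- A Laurent generating function `∑_{α ∈ ℤ^σ} c_α x^α`, given by its coefficients `c`. -/
abbrev LaurentGF (σ : Type*) := (σ → ℤ) → ℝ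

/-- Multiplication by the monomial `x^δ`. -/
def LaurentGF.monomialMul {σ : Type*} (δ : σ → ℕ) (c : LaurentGF σ) : LaurentGF σ :=
  fun α => c (fun i => α i - (δ i : ℤ))

/-- The normalization `N (∑_{α ∈ ℤ^σ} c_α x^α) = ∑_{α ∈ ℕ^σ} c_α x^α / α!`. -/
def LaurentGF.normalize {σ : Type*} [Fintype σ] (c : LaurentGF σ) : MvPowerSeries σ ℝ :=
  fun a => c (fun i => (a i : ℤ)) / ∏ i, (Nat.factorial (a i) : ℝ)

/-- The expansion of `∏_{i > j} (1 + x_i x_j⁻¹ + x_i² x_j⁻² + ⋯)`: the coefficient of `x^ν` is the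
number of families of exponents `(k_{ij})_{i > j}` with `∏_{i > j} (x_i x_j⁻¹)^{k_{ij}} = x^ν`. -/
def geometricProduct (m : ℕ) : LaurentGF (Fin m) := fun ν =>
  (Nat.card {k : {p : Fin m × Fin m // p.2 < p.1} → ℕ //
    ∑ p, k p • (Pi.single p.1.1 1 - Pi.single p.1.2 1 : Fin m → ℤ) = ν} : ℝ)

/-! ### Verma modules of `sl_m(ℂ)` -/

/-- The Lie algebra `sl_m(ℂ)`. -/
abbrev SL (m : ℕ) := LieAlgebra.SpecialLinear.sl (Fin m) ℂ

/-- The Cartan subalgebra of diagonal matrices in `sl_m(ℂ)`. -/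
def cartan (m : ℕ) : Submodule ℂ (SL m) where
  carrier := {x | x.val.IsDiag}
  add_mem' hx hy := by
    intro i j hij
    simp [hx hij, hy hij]
  zero_mem' := by
    intro i j _
    simp
  smul_mem' c x hx := by
    intro i j hij
    simp [hx hij]

/-- The element `E_ii - E_jj` of the Cartan subalgebra. -/
def coroot (m : ℕ) (i j : Fin m) : cartan m :=
  ⟨LieAlgebra.SpecialLinear.singleSubSingle i j 1, by
    intro a b hab
    simp only [LieAlgebra.SpecialLinear.val_singleSubSingle, Matrix.sub_apply, Matrix.single_apply]
    rw [if_neg (fun h => hab (h.1.symm.trans h.2)), if_neg (fun h => hab (h.1.symm.trans h.2)),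
      sub_zero]⟩

/-- The integral weight lattice `Λ`: the linear forms on the Cartan subalgebra that take integral
values on all coroots. -/
def weightLattice (m : ℕ) : AddSubgroup (Module.Dual ℂ (cartan m)) where
  carrier := {μ | ∀ i j : Fin m, ∃ n : ℤ, μ (coroot m i j) = (n : ℂ)}
  add_mem' hx hy := by
    intro i j
    obtain ⟨a, ha⟩ := hx i j
    obtain ⟨b, hb⟩ := hy i j
    exact ⟨a + b, by simp [ha, hb]⟩
  zero_mem' := fun i j => ⟨0, by simp⟩
  neg_mem' hx := by
    intro i j
    obtain ⟨a, ha⟩ := hx i j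
    exact ⟨-a, by simp [ha]⟩

/-- The weight `∑ ν_i e_i`, where `e_i` sends a diagonal matrix to its `i`-th diagonal entry. -/
def weightOf {m : ℕ} (ν : Fin m → ℤ) : Module.Dual ℂ (cartan m) where
  toFun h := ∑ i, (ν i : ℂ) * h.val.val i i
  map_add' x y := by
    simp [mul_add, Finset.sum_add_distrib]
  map_smul' c x := by
    simp only [RingHom.id_apply, smul_eq_mul, Finset.mul_sum]
    refine Finset.sum_congr rfl fun i _ => ?_
    have h : (c • x).val.val i i = c * x.val.val i i := rfl
    rw [h]
    ring

/-- The universal enveloping algebra of `sl_m(ℂ)`. -/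
abbrev U (m : ℕ) := UniversalEnvelopingAlgebra ℂ (SL m)

/-- The image in the enveloping algebra of an element of `sl_m(ℂ)`. -/
def toU {m : ℕ} (x : SL m) : U m := UniversalEnvelopingAlgebra.ι ℂ x

/-- The left ideal of the enveloping algebra generated by the strictly upper triangular matrices
(the positive root vectors) and by the elements `h - λ(h)` for `h` in the Cartan subalgebra. -/
def vermaIdeal {m : ℕ} (lam : Module.Dual ℂ (cartan m)) : Submodule (U m) (U m) :=
  Submodule.span (U m)
    ({u | ∃ x : SL m, (∀ i j : Fin m, j ≤ i → x.val i j = 0) ∧ u = toU x} ∪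
     {u | ∃ h : cartan m, u = toU h.val - algebraMap ℂ (U m) (lam h)})

/-- The Verma module `M(λ)`, the universal highest weight module of highest weight `λ`. -/
abbrev Verma {m : ℕ} (lam : Module.Dual ℂ (cartan m)) := U m ⧸ vermaIdeal lam

/-- The weight space `M(λ)_μ`. -/
def weightSpace {m : ℕ} (lam μ : Module.Dual ℂ (cartan m)) : Submodule ℂ (Verma lam) where
  carrier := {v | ∀ h : cartan m, toU h.val • v = μ h • v}
  add_mem' hx hy := fun h => by rw [smul_add, smul_add, hx h, hy h]
  zero_mem' := fun h => by rw [smul_zero, smul_zero]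
  smul_mem' c x hx := fun h => by
    rw [smul_comm (toU h.val) c x, hx h, smul_comm]

open Classical in
/-- The shifted character `∑_{μ ∈ Λ} dim M(λ)_μ x^{μ - λ}`. A weight `μ - λ` in the root lattice is
`∑ ν_i e_i` for exactly one `ν ∈ ℤ^m` with `∑ ν_i = 0`, and `x^{μ - λ}` is the monomial `x^ν` for
that `ν`; so the coefficient of `x^ν` vanishes unless `ν` has degree zero. -/
def shiftedCharacter {m : ℕ} (lam : Module.Dual ℂ (cartan m)) : LaurentGF (Fin m) := fun ν =>
  if ∑ i, ν i = 0 then (Module.finrank ℂ (weightSpace lam (lam + weightOf ν)) : ℝ) else 0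

end VermaLorentzian

end

/-!
The lower triangular part of `sl_m` has the matrix units at the positions `i > j` as a basis, so a
Poincaré–Birkhoff–Witt basis of the Verma module gives `M(λ)_μ` a basis indexed by the ways to write
`μ - λ` as a sum of negative roots. Spanning is the reordering of products. For independence, the
enveloping algebra acts on polynomial functions of matrices by left invariant differential
operators: distinct ordered products of matrix units have distinct leading symbols at the identity.
A functional that sends the ordered monomial `X^s Y^t`, with `X` strictly lower and `Y` upper
triangular, to `χ(Y^t)` times the basis vector of `s` kills the defining left ideal.

Hence the shifted character is a product of geometric series. A sequence `c` on `ℤ^m` is Lorentzian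
if its matrices `(c (γ + ε_i + ε_j))` have at most one positive eigenvalue. For positive `c` this is
preserved by multiplication by a truncated geometric series in `x_i x_j⁻¹`, which adds up matrices
such that the row `j` of each of them is the row `i` of the next, so that the estimates telescope.
The discrete Gaussian `t ^ (∑ α_i ^ 2)` is Lorentzian and tends to the constant series `1` as
`t → 0`; hence the product of geometric series is a limit of Lorentzian sequences. The Hessians of
the derivatives of a normalization are matrices of its sequence. By summation by parts, the support
consists of the vectors with bounded initial sums, and such a set is `M`-convex.
-/

noncomputable section

namespace VermaLorentzian

/-! ### Lorentzian bilinear forms -/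

section Forms

variable {V : Type*} [AddCommGroup V] [Module ℝ V]

/-- A bilinear form satisfies the reversed Cauchy–Schwarz inequality on its positive vectors. For a
symmetric form on a finite-dimensional space this says that it has at most one positive
eigenvalue, but it is stable under limits and makes sense without diagonalization. -/
def IsLorentzForm (A : LinearMap.BilinForm ℝ V) : Prop :=
  ∀ v x : V, 0 < A v v → A v v * A x x ≤ A v x ^ 2

theorem isLorentzForm_of_nonpos_on_ker {A : LinearMap.BilinForm ℝ V} (hA : A.IsSymm)
    (l : V →ₗ[ℝ] ℝ) (h : ∀ x, l x = 0 → A x x ≤ 0) : IsLorentzForm A := by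
  intro v x hv
  have hl : l v ≠ 0 := fun h0 => absurd (h v h0) (not_le.mpr hv)
  have hker := h (x - (l x / l v) • v) (by simp [hl])
  generalize l x / l v = t at hker
  simp only [map_sub, map_smul, LinearMap.sub_apply, LinearMap.smul_apply, smul_eq_mul,
    hA.eq x v] at hker
  nlinarith [sq_nonneg (A v x - t * A v v), mul_nonneg hv.le (sub_nonneg.mpr hker)]

theorem IsLorentzForm.nonpos_of_orthogonal {A : LinearMap.BilinForm ℝ V} (hA : IsLorentzForm A)
    {v x : V} (hv : 0 < A v v) (hx : A v x = 0) : A x x ≤ 0 := by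
  have h := hA v x hv
  rw [hx] at h
  nlinarith

variable {A : ℕ → LinearMap.BilinForm ℝ V} {p q : V}

/-- The scalars `u k` make `x - u k • p + u (k + 1) • q` orthogonal to `q` for `A k`, so `A k` is
nonpositive on this vector; up to a square, the cross terms telescope. -/
theorem sum_apply_self_nonpos_of_linked (hsymm : ∀ k, (A k).IsSymm)
    (hA : ∀ k, IsLorentzForm (A k)) (hpq : ∀ k x, A k q x = A (k + 1) p x)
    (hpos : ∀ k, 0 < A k p p) {n : ℕ} {x : V} (hx : ∑ k ∈ Finset.range (n + 1), A k q x = 0) :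
    ∑ k ∈ Finset.range (n + 1), A k x x ≤ 0 := by
  set S : ℕ → ℝ := fun k => ∑ r ∈ Finset.range k, A r q x with hS
  set u : ℕ → ℝ := fun k => -S k / A (k + 1) p p with hu
  set T : ℕ → ℝ := fun k => 2 * u k * A k p x + u k ^ 2 * (A (k + 1) p p - A k p p) with hT
  have hqp : ∀ k, A k q p = A (k + 1) p p := fun k => hpq k p
  have hqq : ∀ k, A k q q = A (k + 2) p p := fun k => by rw [hpq, (hsymm _).eq, hpq]
  have hu_mul : ∀ k, u k * A (k + 1) p p = -S k := fun k => div_mul_cancel₀ _ (hpos (k + 1)).ne'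
  have horth : ∀ k, A k q (x - u k • p + u (k + 1) • q) = 0 := fun k => by
    simp only [map_add, map_sub, map_smul, smul_eq_mul, hqp, hqq]
    linarith [hu_mul k, hu_mul (k + 1), Finset.sum_range_succ (fun r => A r q x) k]
  have hstep : ∀ k, A k x x ≤ T k - T (k + 1) := fun k => by
    have h := (hA k).nonpos_of_orthogonal (by rw [hqq]; exact hpos _) (horth k)
    simp only [map_add, map_sub, map_smul, LinearMap.add_apply, LinearMap.sub_apply,
      LinearMap.smul_apply, smul_eq_mul, hqq, hqp, (hsymm k).eq x p, (hsymm k).eq x q,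
      (hsymm k).eq p q] at h
    simp only [hT, ← hpq]
    rw [hpq k p, hpq (k + 1) p]
    nlinarith [mul_nonneg (hpos (k + 1)).le (sq_nonneg (u k - u (k + 1)))]
  calc ∑ k ∈ Finset.range (n + 1), A k x x
      ≤ ∑ k ∈ Finset.range (n + 1), (T k - T (k + 1)) := Finset.sum_le_sum fun k _ => hstep k
    _ = T 0 - T (n + 1) := Finset.sum_range_sub' _ _
    _ = 0 := by simp [hT, hu, hS, hx]

theorem isLorentzForm_sum_of_linked (hsymm : ∀ k, (A k).IsSymm) (hA : ∀ k, IsLorentzForm (A k))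
    (hpq : ∀ k x, A k q x = A (k + 1) p x) (hpos : ∀ k, 0 < A k p p) (n : ℕ) :
    IsLorentzForm (∑ k ∈ Finset.range (n + 1), A k) := by
  refine isLorentzForm_of_nonpos_on_ker ⟨fun x y => ?_⟩
    (∑ k ∈ Finset.range (n + 1), A k q) fun x hx => ?_
  · simp only [LinearMap.sum_apply, (hsymm _).eq x y]
  · simp only [LinearMap.sum_apply] at hx ⊢
    exact sum_apply_self_nonpos_of_linked hsymm hA hpq hpos hx

end Forms

/-! ### Lorentzian Laurent sequences -/

section Sequences

variable {σ : Type*} [DecidableEq σ]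

/-- The vector `ε_i - ε_j` attached to the pair `(i, j)`; for `i > j` it is the exponent of the
monomial `x_i x_j⁻¹`. -/
def rootVec (p : σ × σ) : σ → ℤ := Pi.single p.1 1 - Pi.single p.2 1

/-- The matrix `(c (γ + ε_i + ε_j))_{i, j}`. When `c` lists the coefficients of a homogeneous
generating function, it is the Hessian of the derivative of order `γ` of its normalization. -/
def shiftMatrix (c : LaurentGF σ) (γ : σ → ℤ) : Matrix σ σ ℝ :=
  Matrix.of fun i j => c (γ + Pi.single i 1 + Pi.single j 1)

theorem shiftMatrix_isSymm (c : LaurentGF σ) (γ : σ → ℤ) : (shiftMatrix c γ).IsSymm := by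
  ext i j
  simp only [shiftMatrix, Matrix.transpose_apply, Matrix.of_apply, add_right_comm]

variable [Fintype σ]

/-- The bilinear form of the matrix `(c (γ + ε_i + ε_j))_{i, j}`. -/
def shiftForm (c : LaurentGF σ) (γ : σ → ℤ) : LinearMap.BilinForm ℝ (σ → ℝ) :=
  Matrix.toBilin' (shiftMatrix c γ)

theorem shiftForm_isSymm (c : LaurentGF σ) (γ : σ → ℤ) : (shiftForm c γ).IsSymm :=
  Matrix.isSymm_toBilin'_iff_isSymm.mpr (shiftMatrix_isSymm c γ)

theorem shiftForm_apply (c : LaurentGF σ) (γ : σ → ℤ) (x y : σ → ℝ) :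
    shiftForm c γ x y = ∑ i, ∑ j, x i * c (γ + Pi.single i 1 + Pi.single j 1) * y j :=
  Matrix.toBilin'_apply _ _ _

theorem shiftForm_single_left (c : LaurentGF σ) (γ : σ → ℤ) (i : σ) (y : σ → ℝ) :
    shiftForm c γ (Pi.single i 1) y = ∑ j, c (γ + Pi.single i 1 + Pi.single j 1) * y j := by
  rw [shiftForm_apply, Finset.sum_eq_single i]
  · simp
  · intro b _ hb
    simp [hb]
  · simp

theorem shiftForm_single_single (c : LaurentGF σ) (γ : σ → ℤ) (i j : σ) :
    shiftForm c γ (Pi.single i 1) (Pi.single j 1) = c (γ + Pi.single i 1 + Pi.single j 1) :=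
  Matrix.toBilin'_single _ _ _

theorem shiftForm_finsetSum {κ : Type*} (s : Finset κ) (c : κ → LaurentGF σ) (γ : σ → ℤ) :
    shiftForm (fun α => ∑ k ∈ s, c k α) γ = ∑ k ∈ s, shiftForm (c k) γ := by
  simp only [shiftForm, ← map_sum]
  congr 1
  ext i j
  simp only [Matrix.sum_apply, shiftMatrix, Matrix.of_apply]

theorem shiftForm_translate (c : LaurentGF σ) (γ δ : σ → ℤ) :
    shiftForm (fun α => c (α - δ)) γ = shiftForm c (γ - δ) := by
  simp only [shiftForm, shiftMatrix, add_sub_right_comm]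

/-- All the forms `shiftForm c γ` are Lorentzian. -/
def IsLorentzSeq (c : LaurentGF σ) : Prop := ∀ γ, IsLorentzForm (shiftForm c γ)

theorem IsLorentzSeq.translate {c : LaurentGF σ} (hc : IsLorentzSeq c) (δ : σ → ℤ) :
    IsLorentzSeq fun α => c (α - δ) := fun γ => by
  rw [shiftForm_translate]
  exact hc _

theorem IsLorentzSeq.window {c : LaurentGF σ} (hc : IsLorentzSeq c) (hpos : ∀ α, 0 < c α)
    (p : σ × σ) (n : ℕ) :
    IsLorentzSeq fun α => ∑ k ∈ Finset.range (n + 1), c (α - k • rootVec p) := by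
  intro γ
  rw [shiftForm_finsetSum]
  simp only [shiftForm_translate]
  refine isLorentzForm_sum_of_linked (p := Pi.single p.1 1) (q := Pi.single p.2 1)
    (fun k => shiftForm_isSymm _ _) (fun k => hc _) (fun k x => ?_) (fun k => ?_) n
  · rw [shiftForm_single_left, shiftForm_single_left]
    have h : γ - k • rootVec p + Pi.single p.2 1 =
        γ - (k + 1) • rootVec p + Pi.single p.1 1 := by
      rw [add_smul, one_smul, rootVec]
      abel
    rw [h]
  · rw [shiftForm_single_single]
    exact hpos _

theorem IsLorentzSeq.box {κ : Type*} [Fintype κ] [DecidableEq κ] (r : κ → σ × σ) (n : ℕ)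
    {c : LaurentGF σ} (hc : IsLorentzSeq c) (hpos : ∀ α, 0 < c α) :
    IsLorentzSeq fun α => ∑ k : κ → Fin (n + 1), c (α - ∑ s, (k s : ℕ) • rootVec (r s)) := by
  suffices h : ∀ [Fintype κ] [DecidableEq κ] (r : κ → σ × σ) {c : LaurentGF σ}, IsLorentzSeq c →
      (∀ α, 0 < c α) → IsLorentzSeq fun α =>
        ∑ k : κ → Fin (n + 1), c (α - ∑ s, (k s : ℕ) • rootVec (r s)) from h r hc hpos
  clear * -
  induction κ using Finite.induction_empty_option with
  | of_equiv e ih =>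
    intro _ _ r c hc hpos
    let := Fintype.ofEquiv _ e.symm
    let := e.decidableEq
    convert ih (fun s => r (e s)) hc hpos using 2 with α
    refine Fintype.sum_equiv (e.symm.arrowCongr (Equiv.refl _)) _ _ fun k => congrArg c ?_
    rw [← Equiv.sum_comp e]
    simp
  | h_empty =>
    intro _ _ r c hc _
    simpa using hc
  | @h_option κ _ ih =>
    intro hfin _ r c hc hpos
    classical
    obtain rfl : hfin = instFintypeOption := Subsingleton.elim _ _
    have h := ih (fun s => r (some s)) (hc.window hpos (r none) n)
      fun α => Finset.sum_pos (fun k _ => hpos _) ⟨0, by simp⟩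
    convert h using 2 with α
    rw [← Fintype.sum_equiv (Equiv.piOptionEquivProd (β := fun _ => Fin (n + 1))).symm _ _
      (fun _ => rfl), Fintype.sum_prod_type, Finset.sum_comm]
    refine Finset.sum_congr rfl fun k _ => ?_
    rw [Finset.sum_range]
    refine Finset.sum_congr rfl fun k0 _ => congrArg c ?_
    rw [Fintype.sum_option, ← sub_sub, sub_right_comm]
    rfl

/-- The discrete Gaussian `α ↦ t ^ (∑ α_i ^ 2)`, a positive Lorentzian sequence that tends to the
indicator function of the origin as `t` tends to `0`. -/
def discreteGaussian (t : ℝ) : LaurentGF σ := fun α => t ^ ∑ i, (α i).natAbs ^ 2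

theorem discreteGaussian_add_single_add_single {t : ℝ} (ht : t ≠ 0) (γ : σ → ℤ) (i j : σ) :
    discreteGaussian t (γ + Pi.single i 1 + Pi.single j 1) =
      t ^ (∑ l, γ l ^ 2 + 2) *
        (t ^ (2 * γ i) * t ^ (2 * γ j) * if i = j then t ^ 2 else 1) := by
  have hexp : ((∑ l, ((γ + Pi.single i 1 + Pi.single j 1 : σ → ℤ) l).natAbs ^ 2 : ℕ) : ℤ) =
      (∑ l, γ l ^ 2 + 2) + 2 * γ i + 2 * γ j + if i = j then 2 else 0 := by
    simp only [Nat.cast_sum, Nat.cast_pow, Int.natCast_natAbs, sq_abs]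
    have hsq : ∀ l, (γ + Pi.single i 1 + Pi.single j 1 : σ → ℤ) l ^ 2 = γ l ^ 2 +
        (if i = l then 2 * γ l + 1 else 0) + (if j = l then 2 * γ l + 1 else 0) +
          if i = l then (if i = j then 2 else 0) else 0 := fun l => by
      simp only [Pi.add_apply, Pi.single_apply, eq_comm (a := l)]
      split_ifs <;> first | ring1 | (exfalso; simp_all)
    simp only [hsq, Finset.sum_add_distrib, Finset.sum_ite_eq, Finset.mem_univ, if_true]
    ring
  rw [discreteGaussian, ← zpow_natCast, hexp, zpow_add₀ ht, zpow_add₀ ht, zpow_add₀ ht]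
  split_ifs
  · norm_cast
    ring
  · rw [zpow_zero]
    ring

theorem shiftForm_discreteGaussian_self {t : ℝ} (ht : t ≠ 0) (γ : σ → ℤ) (x : σ → ℝ) :
    shiftForm (discreteGaussian t) γ x x = t ^ (∑ i, γ i ^ 2 + 2) *
      ((∑ i, t ^ (2 * γ i) * x i) ^ 2 - (1 - t ^ 2) * ∑ i, (t ^ (2 * γ i) * x i) ^ 2) := by
  set y : σ → ℝ := fun i => t ^ (2 * γ i) * x i with hy
  have hterm : ∀ i j, x i * discreteGaussian t (γ + Pi.single i 1 + Pi.single j 1) * x j =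
      t ^ (∑ i, γ i ^ 2 + 2) * (y i * y j - (1 - t ^ 2) * if i = j then y i * y j else 0) := by
    intro i j
    rw [discreteGaussian_add_single_add_single ht, hy]
    split_ifs <;> ring
  simp only [shiftForm_apply, hterm, ← Finset.mul_sum, Finset.sum_sub_distrib, Finset.sum_ite_eq,
    Finset.mem_univ, if_true, sq, Finset.sum_mul_sum, y]

theorem isLorentzSeq_discreteGaussian {t : ℝ} (h0 : 0 < t) (h1 : t < 1) :
    IsLorentzSeq (discreteGaussian t : LaurentGF σ) := by
  intro γ
  refine isLorentzForm_of_nonpos_on_ker (shiftForm_isSymm _ _)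
    (∑ i, (t ^ (2 * γ i)) • LinearMap.proj i) fun x hx => ?_
  simp only [LinearMap.sum_apply, LinearMap.smul_apply, LinearMap.proj_apply, smul_eq_mul] at hx
  rw [shiftForm_discreteGaussian_self h0.ne', hx]
  have hsq : 0 ≤ (1 - t ^ 2) * ∑ i, (t ^ (2 * γ i) * x i) ^ 2 :=
    mul_nonneg (by nlinarith) (Finset.sum_nonneg fun i _ => sq_nonneg _)
  nlinarith [mul_nonneg (zpow_pos h0 (∑ i, γ i ^ 2 + 2)).le hsq]

open Filter Topology

theorem tendsto_discreteGaussian {τ : Type*} [Fintype τ] (α : τ → ℤ) :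
    Tendsto (fun t : ℝ => discreteGaussian t α) (𝓝[>] 0) (𝓝 (if α = 0 then 1 else 0)) := by
  have h : (if α = 0 then (1 : ℝ) else 0) = discreteGaussian 0 α := by
    rw [discreteGaussian, zero_pow_eq]
    congr 1
    simp [Finset.sum_eq_zero_iff, funext_iff]
  rw [h]
  exact ((continuous_pow _).tendsto (0 : ℝ)).mono_left nhdsWithin_le_nhds

theorem IsLorentzSeq.of_tendsto {ι : Type*} {l : Filter ι} [l.NeBot] {f : ι → LaurentGF σ}
    {c : LaurentGF σ} (hf : ∀ᶠ t in l, IsLorentzSeq (f t))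
    (hlim : ∀ α, Tendsto (fun t => f t α) l (𝓝 (c α))) : IsLorentzSeq c := by
  intro γ v x hv
  have hform : ∀ x y, Tendsto (fun t => shiftForm (f t) γ x y) l (𝓝 (shiftForm c γ x y)) := by
    intro x y
    simp only [shiftForm_apply]
    exact tendsto_finsetSum _ fun i _ => tendsto_finsetSum _ fun j _ =>
      ((hlim _).const_mul _).mul_const _
  refine le_of_tendsto_of_tendsto ((hform v v).mul (hform x x)) ((hform v x).pow 2) ?_
  filter_upwards [hf, (hform v v).eventually_const_lt hv] with t ht hpos
  exact ht γ v x hpos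

theorem isLorentzSeq_boxCount {κ : Type*} [Fintype κ] [DecidableEq κ] (r : κ → σ × σ) (n : ℕ) :
    IsLorentzSeq fun α => ∑ k : κ → Fin (n + 1),
      if α - ∑ s, (k s : ℕ) • rootVec (r s) = 0 then (1 : ℝ) else 0 := by
  refine IsLorentzSeq.of_tendsto (l := 𝓝[>] (0 : ℝ)) ?_ fun α =>
    tendsto_finsetSum _ fun k _ => tendsto_discreteGaussian _
  filter_upwards [Ioo_mem_nhdsGT (zero_lt_one' ℝ)] with t ht
  exact (isLorentzSeq_discreteGaussian ht.1 ht.2).box r n fun α => pow_pos ht.1 _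

end Sequences

/-! ### `M`-convexity of nested sets -/

section Nested

variable {ι : Type*} [LinearOrder ι] [LocallyFiniteOrderBot ι]

theorem eq_of_sum_Iic_eq [WellFoundedLT ι] {α β : ι → ℤ}
    (h : ∀ t, ∑ l ∈ Finset.Iic t, α l = ∑ l ∈ Finset.Iic t, β l) : α = β := by
  funext i
  induction i using WellFoundedLT.induction with
  | ind i ih =>
    have hi := h i
    rw [← Finset.Iio_insert, Finset.sum_insert (by simp), Finset.sum_insert (by simp),
      Finset.sum_congr rfl fun j hj => ih j (Finset.mem_Iio.mp hj)] at hi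
    exact add_right_cancel hi

variable [Fintype ι]

/-- The nonnegative integral vectors with the same sum as `d` and with initial sums at most those
of `d`. These turn out to be the supports of the normalized shifted characters. -/
def nestedSet (d : ι → ℤ) : Set (ι → ℤ) :=
  {α | (∀ i, 0 ≤ α i) ∧ ∑ i, α i = ∑ i, d i ∧
    ∀ t, ∑ l ∈ Finset.Iic t, α l ≤ ∑ l ∈ Finset.Iic t, d l}

variable {d α β : ι → ℤ} {i j : ι}

theorem sub_single_add_single_mem_nestedSet (hα : α ∈ nestedSet d) (hi : 0 < α i)
    (hslack : ∀ t, j ≤ t → t < i → ∑ l ∈ Finset.Iic t, α l < ∑ l ∈ Finset.Iic t, d l) :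
    α - Pi.single i 1 + Pi.single j 1 ∈ nestedSet d := by
  obtain ⟨hnonneg, hsum, hle⟩ := hα
  refine ⟨fun l => ?_, ?_, fun t => ?_⟩
  · have := hnonneg l
    simp only [Pi.add_apply, Pi.sub_apply, Pi.single_apply]
    split_ifs with h1 h2 <;> first | omega | (subst h1; omega)
  · simpa [Finset.sum_add_distrib, Finset.sum_sub_distrib, Pi.single_apply] using hsum
  · have hslack := hslack t
    have := hle t
    simp only [Pi.add_apply, Pi.sub_apply, Finset.sum_add_distrib, Finset.sum_sub_distrib,
      Finset.sum_pi_single', Finset.mem_Iic]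
    split_ifs with hit hjt hjt
    · linarith
    · linarith
    · linarith [hslack hjt (not_le.mp hit)]
    · linarith

theorem exists_exchange_left (hα : α ∈ nestedSet d) (hβ : β ∈ nestedSet d) (hi : β i < α i)
    {T : Finset ι} (hT : Finset.Iic i ⊆ T) (hsum : ∑ l ∈ T, α l ≤ ∑ l ∈ T, β l)
    (hge : ∀ l ∈ T, i < l → β l ≤ α l) :
    ∃ j, α j < β j ∧ α - Pi.single i 1 + Pi.single j 1 ∈ nestedSet d ∧
      β - Pi.single j 1 + Pi.single i 1 ∈ nestedSet d := by
  have hlt : ∑ l ∈ Finset.Iio i, α l < ∑ l ∈ Finset.Iio i, β l := by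
    have hsub : Finset.Iio i ⊆ T := Finset.Iio_subset_Iic_self.trans hT
    have h : ∑ l ∈ T \ Finset.Iio i, β l < ∑ l ∈ T \ Finset.Iio i, α l := by
      refine Finset.sum_lt_sum (fun l hl => ?_) ⟨i, by simp [hT (Finset.mem_Iic.mpr le_rfl)], hi⟩
      simp only [Finset.mem_sdiff, Finset.mem_Iio, not_lt] at hl
      rcases hl.2.eq_or_lt with rfl | h
      · exact hi.le
      · exact hge l hl.1 h
    linarith [Finset.sum_sdiff hsub (f := α), Finset.sum_sdiff hsub (f := β)]
  obtain ⟨j, hj, hmax⟩ := Finset.exists_max_image ((Finset.Iio i).filter fun j => α j < β j) id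
    (by obtain ⟨j, hj, hlt⟩ := Finset.exists_lt_of_sum_lt hlt
        exact ⟨j, Finset.mem_filter.mpr ⟨hj, hlt⟩⟩)
  simp only [Finset.mem_filter, Finset.mem_Iio, id] at hj hmax
  refine ⟨j, hj.2,
    sub_single_add_single_mem_nestedSet hα ((hβ.1 i).trans_lt hi) fun t hjt hti => ?_,
    sub_single_add_single_mem_nestedSet hβ ((hα.1 j).trans_lt hj.2)
      fun t hit htj => absurd (hit.trans_lt htj) hj.1.not_gt⟩
  refine lt_of_lt_of_le ?_ (hβ.2.2 t)
  have hsub : Finset.Iic t ⊆ Finset.Iio i := fun l hl =>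
    Finset.mem_Iio.mpr ((Finset.mem_Iic.mp hl).trans_lt hti)
  have h : ∑ l ∈ Finset.Iio i \ Finset.Iic t, β l ≤ ∑ l ∈ Finset.Iio i \ Finset.Iic t, α l := by
    refine Finset.sum_le_sum fun l hl => ?_
    simp only [Finset.mem_sdiff, Finset.mem_Iio, Finset.mem_Iic, not_le] at hl
    by_contra! h
    exact absurd (hjt.trans_lt hl.2) (not_lt.mpr (hmax l ⟨hl.1, h⟩))
  linarith [Finset.sum_sdiff hsub (f := α), Finset.sum_sdiff hsub (f := β)]

theorem mConvex_nestedSet (d : ι → ℤ) : MConvex (nestedSet d) := by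
  intro i α hα β hβ hi
  by_cases hright : ∃ j, i < j ∧ α j < β j
  · obtain ⟨j, hj, hmin⟩ := Finset.exists_min_image
      (Finset.univ.filter fun j => i < j ∧ α j < β j) id
      (hright.imp fun j hj => Finset.mem_filter.mpr ⟨Finset.mem_univ j, hj⟩)
    simp only [Finset.mem_filter, Finset.mem_univ, true_and, id] at hj hmin
    by_cases htight : ∃ u, i ≤ u ∧ u < j ∧ ∑ l ∈ Finset.Iic u, d l ≤ ∑ l ∈ Finset.Iic u, β l
    · obtain ⟨u, hiu, huj, hu⟩ := htight
      refine exists_exchange_left hα hβ hi (Finset.Iic_subset_Iic.mpr hiu)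
        ((hα.2.2 u).trans hu) fun l hlu hil => ?_
      by_contra! h
      exact absurd ((Finset.mem_Iic.mp hlu).trans_lt huj) (not_lt.mpr (hmin l ⟨hil, h⟩))
    · push Not at htight
      exact ⟨j, hj.2,
        sub_single_add_single_mem_nestedSet hα ((hβ.1 i).trans_lt hi)
          fun t hjt hti => absurd (hjt.trans_lt hti) hj.1.not_gt,
        sub_single_add_single_mem_nestedSet hβ ((hα.1 j).trans_lt hj.2) htight⟩
  · push Not at hright
    exact exists_exchange_left hα hβ hi (Finset.subset_univ _) (hα.2.1.trans hβ.2.1.symm).le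
      fun l _ => hright l

end Nested

/-! ### Kostant's partition function -/

section Kostant

/-- The negative roots `ε_i - ε_j`, `i > j`, as pairs `(i, j)`. -/
abbrev NegRoot (m : ℕ) := {p : Fin m × Fin m // p.2 < p.1}

/-- The vector `∑ k_{ij} (ε_i - ε_j)`. The coefficient of `x^ν` in the product of the geometric
series `∑ x_i^k x_j^{-k}`, `i > j`, is the number of `k` in the fibre over `ν`. -/
def rootSum (m : ℕ) : (NegRoot m → ℕ) →ₗ[ℕ] (Fin m → ℤ) :=
  Fintype.linearCombination ℕ fun p => rootVec p.1

variable {m : ℕ}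

theorem sum_rootSum_mul (k : NegRoot m → ℕ) (w : Fin m → ℤ) :
    ∑ i, rootSum m k i * w i = ∑ p, (k p : ℤ) * (w p.1.1 - w p.1.2) := by
  simp only [rootSum, Fintype.linearCombination_apply, Finset.sum_apply, Finset.sum_mul]
  rw [Finset.sum_comm]
  refine Finset.sum_congr rfl fun p _ => ?_
  simp [rootVec, mul_sub, sub_mul, Pi.single_apply, Finset.sum_sub_distrib]

theorem sum_rootSum (k : NegRoot m → ℕ) : ∑ i, rootSum m k i = 0 := by
  simpa using sum_rootSum_mul k 1

theorem sum_Iic_rootSum_nonpos (k : NegRoot m → ℕ) (t : Fin m) :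
    ∑ l ∈ Finset.Iic t, rootSum m k l ≤ 0 := by
  have h := sum_rootSum_mul k fun i => if i ≤ t then 1 else 0
  simp only [mul_ite, mul_one, mul_zero, ← Finset.sum_filter] at h
  rw [show Finset.Iic t = Finset.univ.filter (· ≤ t) by ext; simp, h]
  refine Finset.sum_nonpos fun p _ => mul_nonpos_of_nonneg_of_nonpos (Int.natCast_nonneg _) ?_
  have := p.2
  split_ifs <;> omega

/-- Pairing `rootSum m k` with the height `∑ i, i ε_i` bounds all the coordinates of `k`. -/
theorem le_natAbs_sum_rootSum_mul (k : NegRoot m → ℕ) (p : NegRoot m) :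
    k p ≤ (∑ i, rootSum m k i * (i : ℕ)).natAbs := by
  have hle : ∀ q : NegRoot m, (k q : ℤ) ≤ k q * (((q.1.1 : ℕ) : ℤ) - (q.1.2 : ℕ)) := fun q => by
    have : (q.1.2 : ℕ) < q.1.1 := q.2
    nlinarith
  have h : (k p : ℤ) ≤ ∑ i, rootSum m k i * (i : ℕ) := by
    rw [sum_rootSum_mul k fun i => ((i : ℕ) : ℤ)]
    exact (hle p).trans (Finset.single_le_sum
      (fun q _ => (Int.natCast_nonneg _).trans (hle q)) (Finset.mem_univ p))
  omega

instance finite_rootSum_fiber (ν : Fin m → ℤ) : Finite {k // rootSum m k = ν} :=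
  Finite.Set.subset (Set.Iic fun _ => (∑ i, ν i * (i : ℕ)).natAbs)
    fun k (hk : rootSum m k = ν) p => hk ▸ le_natAbs_sum_rootSum_mul k p

theorem geometricProduct_eq_card (ν : Fin m → ℤ) :
    geometricProduct m ν = (Nat.card {k // rootSum m k = ν} : ℝ) := rfl

/-- Summation by parts. -/
theorem eq_sum_smul_simpleRoot {n : ℕ} {ν : Fin (n + 1) → ℤ} (hν : ∑ i, ν i = 0) :
    ν = ∑ t : Fin n, (-∑ l ∈ Finset.Iic t.castSucc, ν l) • rootVec (t.succ, t.castSucc) := by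
  have hroot : ∀ (t : Fin n) u, ∑ l ∈ Finset.Iic u, rootVec (t.succ, t.castSucc) l =
      if u = t.castSucc then -1 else 0 := by
    intro t u
    simp only [rootVec, Pi.sub_apply, Finset.sum_sub_distrib, Finset.sum_pi_single',
      Finset.mem_Iic, Fin.le_def, Fin.ext_iff, Fin.val_succ, Fin.val_castSucc]
    split_ifs <;> omega
  refine eq_of_sum_Iic_eq fun u => ?_
  simp only [Finset.sum_apply]
  rw [Finset.sum_comm]
  simp only [Pi.smul_apply, smul_eq_mul, ← Finset.mul_sum, hroot]
  induction u using Fin.lastCases with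
  | last =>
    have hlast : Finset.Iic (Fin.last n) = Finset.univ := Finset.Iic_top
    rw [hlast, hν]
    exact (Finset.sum_eq_zero fun t _ => by simp [(Fin.castSucc_lt_last t).ne']).symm
  | cast t => simp

theorem exists_rootSum_eq_iff {ν : Fin m → ℤ} : (∃ k, rootSum m k = ν) ↔
    ∑ i, ν i = 0 ∧ ∀ t, ∑ l ∈ Finset.Iic t, ν l ≤ 0 := by
  refine ⟨?_, fun ⟨hsum, hle⟩ => ?_⟩
  · rintro ⟨k, rfl⟩
    exact ⟨sum_rootSum k, sum_Iic_rootSum_nonpos k⟩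
  obtain _ | n := m
  · exact ⟨0, Subsingleton.elim _ _⟩
  suffices hν : ν ∈ LinearMap.range (rootSum (n + 1)) from hν
  rw [eq_sum_smul_simpleRoot hsum, rootSum, Fintype.range_linearCombination]
  refine Submodule.sum_mem _ fun t _ => ?_
  rw [← Int.toNat_of_nonneg (neg_nonneg.mpr (hle t.castSucc)), natCast_zsmul]
  exact Submodule.smul_mem _ _ (Submodule.subset_span
    ⟨⟨(t.succ, t.castSucc), Fin.castSucc_lt_succ⟩, rfl⟩)

theorem geometricProduct_ne_zero_iff {ν : Fin m → ℤ} : geometricProduct m ν ≠ 0 ↔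
    ∑ i, ν i = 0 ∧ ∀ t, ∑ l ∈ Finset.Iic t, ν l ≤ 0 := by
  rw [← exists_rootSum_eq_iff, geometricProduct_eq_card, Nat.cast_ne_zero, Nat.card_ne_zero]
  simp [finite_rootSum_fiber, nonempty_subtype]

theorem geometricProduct_eq_boxCount {ν : Fin m → ℤ} {n : ℕ}
    (hn : (∑ i, ν i * (i : ℕ)).natAbs ≤ n) :
    geometricProduct m ν = ∑ k : NegRoot m → Fin (n + 1),
      if ν - rootSum m (fun p => k p) = 0 then (1 : ℝ) else 0 := by
  rw [geometricProduct_eq_card, Finset.sum_boole, ← Fintype.card_subtype,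
    ← Nat.card_eq_fintype_card]
  congr 1
  refine Nat.card_congr
    ⟨fun k => ⟨fun p => ⟨k.1 p, ?_⟩, sub_eq_zero.mpr k.2.symm⟩,
      fun k => ⟨fun p => k.1 p, (sub_eq_zero.mp k.2).symm⟩, fun _ => rfl, fun _ => rfl⟩
  have := le_natAbs_sum_rootSum_mul k.1 p
  rw [k.2] at this
  omega

theorem isLorentzSeq_geometricProduct (m : ℕ) : IsLorentzSeq (geometricProduct m) := by
  refine IsLorentzSeq.of_tendsto (l := Filter.atTop) (Filter.Eventually.of_forall fun n =>
    isLorentzSeq_boxCount (fun p : NegRoot m => p.1) n) fun ν => ?_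
  exact tendsto_atTop_of_eventually_const (i₀ := (∑ i, ν i * (i : ℕ)).natAbs)
    fun n hn => (geometricProduct_eq_boxCount hn).symm

end Kostant

/-! ### Lorentzian polynomials from Lorentzian sequences -/

section Polynomials

variable {σ : Type*} [Fintype σ]

/-- `p` is the exponential generating function of the values of `c` on `ℕ^σ`: it is the polynomial
`c.normalize`, with the factorials moved to the other side. -/
def IsEGF (p : MvPolynomial σ ℝ) (c : LaurentGF σ) : Prop :=
  ∀ a : σ →₀ ℕ, p.coeff a * ∏ i, ((a i).factorial : ℝ) = c fun i => (a i : ℤ)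

theorem prod_factorial_pos (a : σ →₀ ℕ) : 0 < ∏ i, ((a i).factorial : ℝ) :=
  Finset.prod_pos fun _ _ => Nat.cast_pos.mpr (Nat.factorial_pos _)

theorem exists_isEGF {c : LaurentGF σ} {d : ℕ} (hd : ∀ α, c α ≠ 0 → ∑ i, α i = d) :
    ∃ p : MvPolynomial σ ℝ, (p : MvPowerSeries σ ℝ) = c.normalize ∧ IsEGF p c := by
  classical
  set p : MvPolynomial σ ℝ := ∑ a ∈ Finset.univ.finsuppAntidiag d,
    monomial a (MvPowerSeries.coeff a c.normalize)
  have hp : ∀ a, p.coeff a = MvPowerSeries.coeff a c.normalize := by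
    intro a
    simp only [p, coeff_sum, coeff_monomial]
    rw [Finset.sum_eq_single a (fun _ _ hb => if_neg hb), if_pos rfl]
    intro ha
    have hca : c (fun i => (a i : ℤ)) = 0 := by
      by_contra h
      refine ha (Finset.mem_finsuppAntidiag.mpr ⟨?_, Finset.subset_univ _⟩)
      exact_mod_cast hd _ h
    rw [if_pos rfl]
    change c (fun i => (a i : ℤ)) / _ = 0
    rw [hca, zero_div]
  refine ⟨p, ?_, fun a => ?_⟩
  · ext a
    rw [coeff_coe, hp]
  · rw [hp]
    exact div_mul_cancel₀ _ (prod_factorial_pos a).ne'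

section Basic

variable {p : MvPolynomial σ ℝ} {c : LaurentGF σ}

theorem IsEGF.coeff_ne_zero_iff (h : IsEGF p c) {a : σ →₀ ℕ} :
    p.coeff a ≠ 0 ↔ c (fun i => (a i : ℤ)) ≠ 0 := by
  rw [← h a, mul_ne_zero_iff, and_iff_left (prod_factorial_pos a).ne']

theorem IsEGF.coeff_nonneg (h : IsEGF p c) (hc : ∀ α, 0 ≤ c α) (a : σ →₀ ℕ) : 0 ≤ p.coeff a :=
  nonneg_of_mul_nonneg_left (h a ▸ hc _) (prod_factorial_pos a)

theorem IsEGF.isHomogeneous (h : IsEGF p c) {d : ℕ} (hd : ∀ α, c α ≠ 0 → ∑ i, α i = d) :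
    p.IsHomogeneous d := by
  intro a ha
  rw [show Finsupp.weight (1 : σ → ℕ) a = a.degree from
    (DFunLike.congr_fun (Finsupp.degree_eq_weight_one (R := ℕ)) a).symm, Finsupp.degree_eq_sum]
  exact_mod_cast hd _ (h.coeff_ne_zero_iff.mp ha)

theorem IsEGF.expSupport_eq (h : IsEGF p c) :
    expSupport p = {α | (∀ i, 0 ≤ α i) ∧ c α ≠ 0} := by
  ext α
  constructor
  · rintro ⟨a, ha, hα⟩
    obtain rfl : α = fun i => (a i : ℤ) := funext hα
    exact ⟨fun i => Int.natCast_nonneg _, h.coeff_ne_zero_iff.mp (mem_support_iff.mp ha)⟩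
  · rintro ⟨hα, hcα⟩
    lift α to σ → ℕ using hα
    exact ⟨Finsupp.equivFunOnFinite.symm α,
      mem_support_iff.mpr (h.coeff_ne_zero_iff.mpr hcα), fun i => rfl⟩

theorem prod_factorial_add_single (a : σ →₀ ℕ) (i : σ) :
    ∏ j, (((a + Finsupp.single i 1 : σ →₀ ℕ) j).factorial : ℝ) =
      (a i + 1) * ∏ j, ((a j).factorial : ℝ) := by
  classical
  rw [← Finset.mul_prod_erase _ _ (Finset.mem_univ i),
    ← Finset.mul_prod_erase _ (fun j => ((a j).factorial : ℝ)) (Finset.mem_univ i), ← mul_assoc]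
  congr 1
  · simp [Nat.factorial_succ]
  · refine Finset.prod_congr rfl fun j hj => ?_
    rw [Finsupp.add_apply, Finsupp.single_eq_of_ne (Finset.ne_of_mem_erase hj), add_zero]

theorem IsEGF.pderiv [DecidableEq σ] (h : IsEGF p c) (i : σ) :
    IsEGF (pderiv i p) fun α => c (α + Pi.single i 1) := by
  intro a
  have hcast : (fun j => (((a + Finsupp.single i 1 : σ →₀ ℕ) j : ℕ) : ℤ)) =
      (fun j => (a j : ℤ)) + Pi.single i 1 := by
    funext j
    simp [Finsupp.single_apply, Pi.single_apply, eq_comm]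
  rw [coeff_pderiv, mul_assoc, ← prod_factorial_add_single, h, hcast]

theorem IsEGF.iterPDeriv (h : IsEGF p c) (s : List σ) :
    ∃ γ, IsEGF (iterPDeriv s p) fun α => c (α - γ) := by
  classical
  induction s with
  | nil => exact ⟨0, by simpa [VermaLorentzian.iterPDeriv] using h⟩
  | cons i s ih =>
    obtain ⟨γ, hγ⟩ := ih
    refine ⟨γ - Pi.single i 1, ?_⟩
    simp only [sub_sub_eq_add_sub]
    exact hγ.pderiv i

end Basic

variable [DecidableEq σ]

theorem atMostOnePosEigenvalue_of_isLorentzForm {q : MvPolynomial σ ℝ}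
    (h : IsLorentzForm (Matrix.toBilin' (hessian q))) : AtMostOnePosEigenvalue q := by
  rw [AtMostOnePosEigenvalue, Finset.card_le_one]
  intro i hi j hj
  simp only [Finset.mem_filter, Finset.mem_univ, true_and] at hi hj
  by_contra hij
  set hH := hessian_isHermitian q
  have hform : ∀ a b, Matrix.toBilin' (hessian q) (hH.eigenvectorBasis a)
      (hH.eigenvectorBasis b) = hH.eigenvalues b * if a = b then 1 else 0 := by
    intro a b
    rw [Matrix.toBilin'_apply', hH.mulVec_eigenvectorBasis, dotProduct_smul, smul_eq_mul]
    congr 1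
    have := orthonormal_iff_ite.mp hH.eigenvectorBasis.orthonormal b a
    rw [EuclideanSpace.inner_eq_star_dotProduct] at this
    simpa [eq_comm] using this
  have hcs := h (hH.eigenvectorBasis i) (hH.eigenvectorBasis j) (by rw [hform]; simpa using hi)
  rw [hform, hform, hform, if_neg hij, if_pos rfl, if_pos rfl] at hcs
  nlinarith [mul_pos hi hj]

variable {p : MvPolynomial σ ℝ} {c : LaurentGF σ}

theorem IsEGF.hessian_eq (h : IsEGF p c) : hessian p = shiftMatrix c 0 := by
  ext i j
  have := ((h.pderiv j).pderiv i) 0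
  simp only [Finsupp.coe_zero, Pi.zero_apply, Nat.factorial_zero, Nat.cast_one,
    Finset.prod_const_one, mul_one, Nat.cast_zero] at this
  exact this

theorem IsEGF.isLorentzian (h : IsEGF p c) (hc : IsLorentzSeq c) (hnonneg : ∀ α, 0 ≤ c α) {d : ℕ}
    (hd : ∀ α, c α ≠ 0 → ∑ i, α i = d) (hJ : MConvex {α | (∀ i, 0 ≤ α i) ∧ c α ≠ 0}) :
    IsLorentzian p := by
  refine ⟨d, h.isHomogeneous hd, h.coeff_nonneg hnonneg, h.expSupport_eq ▸ hJ, fun s _ => ?_⟩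
  obtain ⟨γ, hγ⟩ := h.iterPDeriv s
  refine atMostOnePosEigenvalue_of_isLorentzForm ?_
  rw [hγ.hessian_eq]
  exact hc.translate γ 0

end Polynomials

theorem monomialMul_geometricProduct_ne_zero_iff {m : ℕ} {δ : Fin m → ℕ} {α : Fin m → ℤ} :
    (geometricProduct m).monomialMul δ α ≠ 0 ↔ ∑ i, α i = ∑ i, (δ i : ℤ) ∧
      ∀ t, ∑ l ∈ Finset.Iic t, α l ≤ ∑ l ∈ Finset.Iic t, (δ l : ℤ) := by
  rw [LaurentGF.monomialMul, geometricProduct_ne_zero_iff]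
  simp only [Finset.sum_sub_distrib, sub_eq_zero, sub_nonpos]

theorem exists_isLorentzian_normalize {m : ℕ} (δ : Fin m → ℕ) :
    ∃ p : MvPolynomial (Fin m) ℝ,
      (p : MvPowerSeries (Fin m) ℝ) = ((geometricProduct m).monomialMul δ).normalize ∧
      IsLorentzian p := by
  have hd : ∀ α, (geometricProduct m).monomialMul δ α ≠ 0 → ∑ i, α i = (∑ i, δ i : ℕ) := by
    intro α hα
    rw [(monomialMul_geometricProduct_ne_zero_iff.mp hα).1, Nat.cast_sum]
  have hsupp : {α | (∀ i, 0 ≤ α i) ∧ (geometricProduct m).monomialMul δ α ≠ 0} =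
      nestedSet fun i => (δ i : ℤ) := by
    ext α
    exact and_congr_right fun _ => monomialMul_geometricProduct_ne_zero_iff
  obtain ⟨p, hp, hegf⟩ := exists_isEGF hd
  exact ⟨p, hp, hegf.isLorentzian ((isLorentzSeq_geometricProduct m).translate fun i => (δ i : ℤ))
    (fun _ => Nat.cast_nonneg _) hd (hsupp ▸ mConvex_nestedSet _)⟩

/-! ### Reordering products in an associative algebra -/

section Reordering

variable {K A ι : Type*} [CommRing K] [Ring A] [Algebra K A]

variable (K) in
/-- The span of the products of at most `n` of the elements `X i`: the degree filtration of the
subalgebra that they generate. -/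
def prodSpan (X : ι → A) (n : ℕ) : Submodule K A :=
  Submodule.span K ((fun l : List ι => (l.map X).prod) '' {l | l.length ≤ n})

theorem span_range_mul_prodSpan_le (X : ι → A) (n : ℕ) :
    Submodule.span K (Set.range X) * prodSpan K X n ≤ prodSpan K X (n + 1) := by
  rw [prodSpan, Submodule.span_mul_span, Submodule.span_le]
  rintro _ ⟨_, ⟨i, rfl⟩, _, ⟨l, hl, rfl⟩, rfl⟩
  exact Submodule.subset_span ⟨i :: l, Nat.succ_le_succ hl, by simp⟩

variable {X : ι → A} (hX : ∀ i j, X i * X j - X j * X i ∈ Submodule.span K (Set.range X))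

include hX

theorem prod_sub_prod_mem_prodSpan_of_perm {l l' : List ι} (h : l.Perm l') :
    ∀ n, l.length ≤ n + 1 → (l.map X).prod - (l'.map X).prod ∈ prodSpan K X n := by
  induction h with
  | nil => simp
  | @cons i l l' hp ih =>
    intro n hn
    rw [List.map_cons, List.map_cons, List.prod_cons, List.prod_cons, ← mul_sub]
    obtain _ | n := n
    · obtain rfl : l = [] := List.length_eq_zero_iff.mp (by simpa using hn)
      simp [hp.nil_eq.symm]
    · exact span_range_mul_prodSpan_le X n
        (Submodule.mul_mem_mul (Submodule.subset_span ⟨i, rfl⟩) (ih n (by simpa using hn)))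
  | swap i j l =>
    intro n hn
    obtain ⟨n, rfl⟩ : ∃ k, n = k + 1 := ⟨n - 1, by simp only [List.length_cons] at hn; omega⟩
    simp only [List.map_cons, List.prod_cons, ← mul_assoc, ← sub_mul]
    exact span_range_mul_prodSpan_le X n
      (Submodule.mul_mem_mul (hX j i) (Submodule.subset_span ⟨l, by simpa using hn, rfl⟩))
  | trans h₁ _ ih₁ ih₂ =>
    intro n hn
    rw [← sub_add_sub_cancel]
    exact add_mem (ih₁ n hn) (ih₂ n (h₁.length_eq ▸ hn))

variable {N : Set (List ι)} (hN : ∀ l : List ι, ∃ l' ∈ N, l.Perm l')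

include hN

theorem prod_mem_span_of_perm (l : List ι) :
    (l.map X).prod ∈ Submodule.span K ((fun l : List ι => (l.map X).prod) '' N) := by
  induction hn : l.length using Nat.strong_induction_on generalizing l with
  | h n ih =>
  obtain ⟨l', hl', hp⟩ := hN l
  have hmem : (l'.map X).prod ∈ Submodule.span K ((fun l : List ι => (l.map X).prod) '' N) :=
    Submodule.subset_span ⟨l', hl', rfl⟩
  obtain _ | n := n
  · obtain rfl : l = [] := List.length_eq_zero_iff.mp hn
    rwa [← hp.nil_eq] at hmem
  · rw [← sub_add_cancel (l.map X).prod (l'.map X).prod]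
    refine add_mem (Submodule.span_le.mpr ?_
      (prod_sub_prod_mem_prodSpan_of_perm hX hp n hn.le)) hmem
    rintro _ ⟨l₂, hl₂, rfl⟩
    exact ih _ (Nat.lt_succ_of_le hl₂) l₂ rfl

theorem adjoin_le_span_of_perm :
    Subalgebra.toSubmodule (Algebra.adjoin K (Set.range X)) ≤
      Submodule.span K ((fun l : List ι => (l.map X).prod) '' N) := by
  rw [Algebra.adjoin_eq_span, Submodule.span_le]
  intro x hx
  obtain ⟨l, hl, rfl⟩ := Submonoid.exists_list_of_mem_closure hx
  obtain ⟨l, rfl⟩ : l ∈ Set.range (List.map X) := by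
    rw [Set.range_list_map]
    exact hl
  exact prod_mem_span_of_perm hX hN l

end Reordering

section TriangularDecomposition

variable {K A ι κ : Type*}

theorem perm_toList_coe (l : List ι) : l.Perm (l : Multiset ι).toList := by
  rw [← Multiset.coe_eq_coe, Multiset.coe_toList]

theorem exists_perm_inl_append_inr (l : List (ι ⊕ κ)) :
    ∃ a : Multiset ι × Multiset κ, l.Perm (a.1.toList.map Sum.inl ++ a.2.toList.map Sum.inr) := by
  suffices h : ∃ (s : List ι) (t : List κ), l.Perm (s.map Sum.inl ++ t.map Sum.inr) by
    obtain ⟨s, t, h⟩ := h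
    exact ⟨(s, t), h.trans (((perm_toList_coe s).map _).append ((perm_toList_coe t).map _))⟩
  induction l with
  | nil => exact ⟨[], [], .nil⟩
  | cons x l ih =>
    obtain ⟨s, t, h⟩ := ih
    rcases x with a | b
    · exact ⟨a :: s, t, h.cons _⟩
    · exact ⟨s, b :: t, (h.cons _).trans List.perm_middle.symm⟩

/-- The ordered monomial `X^s Y^t` for `a = (s, t)`. Each of the two factors is multiplied in the
arbitrary order that `Multiset.toList` chooses. -/
def pbwMonomial [Monoid A] (X : ι → A) (Y : κ → A) (a : Multiset ι × Multiset κ) : A :=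
  (a.1.toList.map X).prod * (a.2.toList.map Y).prod

section Ring

variable [CommRing K] [Ring A] [Algebra K A] {X : ι → A} {Y : κ → A}

theorem adjoin_le_span_pbwMonomial
    (hXY : ∀ i j, Sum.elim X Y i * Sum.elim X Y j - Sum.elim X Y j * Sum.elim X Y i ∈
      Submodule.span K (Set.range (Sum.elim X Y))) :
    Subalgebra.toSubmodule (Algebra.adjoin K (Set.range (Sum.elim X Y))) ≤
      Submodule.span K (Set.range (pbwMonomial X Y)) := by
  refine (adjoin_le_span_of_perm hXY (N := Set.range fun a : Multiset ι × Multiset κ =>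
    a.1.toList.map Sum.inl ++ a.2.toList.map Sum.inr) fun l => ?_).trans (Submodule.span_mono ?_)
  · obtain ⟨a, ha⟩ := exists_perm_inl_append_inr l
    exact ⟨_, ⟨a, rfl⟩, ha⟩
  · rintro _ ⟨_, ⟨a, rfl⟩, rfl⟩
    exact ⟨a, by simp [pbwMonomial, Function.comp_def]⟩

theorem span_range_prod_smul_eq_top {M : Type*} [AddCommGroup M] [Module K M] [Module A M]
    [IsScalarTower K A M]
    (hXY : ∀ i j, Sum.elim X Y i * Sum.elim X Y j - Sum.elim X Y j * Sum.elim X Y i ∈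
      Submodule.span K (Set.range (Sum.elim X Y)))
    (hgen : Algebra.adjoin K (Set.range (Sum.elim X Y)) = ⊤) {v : M}
    (hv : Submodule.span A {v} = ⊤) {χ : κ → K} (hχ : ∀ k, Y k • v = χ k • v) :
    Submodule.span K (Set.range fun s : Multiset ι => (s.toList.map X).prod • v) = ⊤ := by
  have hY : ∀ l : List κ, (l.map Y).prod • v = (l.map χ).prod • v := by
    intro l
    induction l with
    | nil => simp
    | cons k l ih =>
      rw [List.map_cons, List.map_cons, List.prod_cons, List.prod_cons, mul_smul, ih, smul_comm, hχ,
        smul_smul, mul_comm]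
  rw [eq_top_iff]
  intro x _
  obtain ⟨u, rfl⟩ := Submodule.mem_span_singleton.mp (hv ▸ Submodule.mem_top : x ∈ _)
  have hu : u ∈ Subalgebra.toSubmodule (Algebra.adjoin K (Set.range (Sum.elim X Y))) :=
    hgen ▸ Algebra.mem_top (R := K)
  have hmap := Submodule.mem_map_of_mem
    (f := (LinearMap.toSpanSingleton A M v).restrictScalars K)
    (adjoin_le_span_pbwMonomial hXY hu)
  rw [Submodule.map_span] at hmap
  refine Submodule.span_le.mpr ?_ hmap
  rintro _ ⟨_, ⟨⟨s, t⟩, rfl⟩, rfl⟩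
  rw [LinearMap.restrictScalars_apply, LinearMap.toSpanSingleton_apply, pbwMonomial, mul_smul, hY,
    smul_comm]
  exact Submodule.smul_mem _ _ (Submodule.subset_span ⟨s, rfl⟩)

/-- The reordering argument, applied to the elements `(Y k, χ k)` of `A × K`: their commutators
lie in their span as soon as `χ` is a character. -/
theorem map_prod_eq_smul_of_perm {V : Type*} [AddCommGroup V] [Module K V] {χ : κ → K}
    (hχ : ∀ a b, (Y a * Y b - Y b * Y a, (0 : K)) ∈
      Submodule.span K (Set.range fun k => (Y k, χ k)))
    {N : Set (List κ)} (hN : ∀ l : List κ, ∃ l' ∈ N, l.Perm l') (Ψ : A →ₗ[K] V) (v : V)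
    (h : ∀ l ∈ N, Ψ (l.map Y).prod = (l.map χ).prod • v) (l : List κ) :
    Ψ (l.map Y).prod = (l.map χ).prod • v := by
  have hprod : ∀ l : List κ,
      (l.map fun k => (Y k, χ k)).prod = ((l.map Y).prod, (l.map χ).prod) := by
    intro l
    ext1
    · simpa [Function.comp_def] using map_list_prod (RingHom.fst A K) (l.map fun k => (Y k, χ k))
    · simpa [Function.comp_def] using map_list_prod (RingHom.snd A K) (l.map fun k => (Y k, χ k))
  have hmem := prod_mem_span_of_perm (X := fun k => (Y k, χ k))
    (fun a b => by simpa [mul_comm (χ a)] using hχ a b) hN l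
  set Θ : A × K →ₗ[K] V := Ψ ∘ₗ LinearMap.fst K A K -
    LinearMap.toSpanSingleton K V v ∘ₗ LinearMap.snd K A K
  have hker : Submodule.span K ((fun l : List κ => (l.map fun k => (Y k, χ k)).prod) '' N) ≤
      LinearMap.ker Θ := by
    rw [Submodule.span_le]
    rintro _ ⟨l', hl', rfl⟩
    simp [Θ, hprod, h l' hl']
  have := hker hmem
  rwa [hprod, LinearMap.mem_ker, LinearMap.sub_apply, sub_eq_zero] at this

end Ring

section Field

variable [Field K] [Ring A] [Algebra K A] {X : ι → A} {Y : κ → A} {χ : κ → K}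

theorem exists_linearMap_prod_mul_prod (hli : LinearIndependent K (pbwMonomial X Y))
    (hχ : ∀ a b, (Y a * Y b - Y b * Y a, (0 : K)) ∈
      Submodule.span K (Set.range fun k => (Y k, χ k))) :
    ∃ Φ : A →ₗ[K] (Multiset ι →₀ K), ∀ (s : Multiset ι) (l : List κ),
      Φ ((s.toList.map X).prod * (l.map Y).prod) = (l.map χ).prod • Finsupp.single s 1 := by
  obtain ⟨Φ, hΦ⟩ := LinearMap.exists_extend ((Module.Basis.span hli).constr K
    fun a => (a.2.toList.map χ).prod • Finsupp.single a.1 (1 : K))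
  refine ⟨Φ, fun s => map_prod_eq_smul_of_perm hχ (N := Set.range Multiset.toList)
    (fun l => ⟨_, ⟨l, rfl⟩, perm_toList_coe l⟩)
    (Φ ∘ₗ LinearMap.mulLeft K (s.toList.map X).prod) (Finsupp.single s 1) ?_⟩
  rintro _ ⟨t, rfl⟩
  have := DFunLike.congr_fun hΦ (Module.Basis.span hli (s, t))
  rw [Module.Basis.constr_basis, LinearMap.comp_apply, Submodule.subtype_apply,
    Module.Basis.span_apply] at this
  exact this

/-- Such a `Φ` factors through the quotient of the algebra by the left ideal generated by the
elements `Y k - χ k`, where it exhibits the independence of the products `X^s`. -/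
theorem exists_linearMap_mul_eq_smul (hli : LinearIndependent K (pbwMonomial X Y))
    (hXY : ∀ i j, Sum.elim X Y i * Sum.elim X Y j - Sum.elim X Y j * Sum.elim X Y i ∈
      Submodule.span K (Set.range (Sum.elim X Y)))
    (hχ : ∀ a b, (Y a * Y b - Y b * Y a, (0 : K)) ∈
      Submodule.span K (Set.range fun k => (Y k, χ k))) :
    ∃ Φ : A →ₗ[K] (Multiset ι →₀ K), (∀ s, Φ (s.toList.map X).prod = Finsupp.single s 1) ∧
      ∀ u ∈ Algebra.adjoin K (Set.range (Sum.elim X Y)),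
        ∀ z ∈ Submodule.span K (Set.range fun k => (Y k, χ k)), Φ (u * z.1) = z.2 • Φ u := by
  obtain ⟨Φ, hΦ⟩ := exists_linearMap_prod_mul_prod hli hχ
  refine ⟨Φ, fun s => by simpa using hΦ s [], fun u hu z hz => ?_⟩
  have hY : ∀ k, Φ (u * Y k) = χ k • Φ u := by
    intro k
    have heq : Set.EqOn (Φ ∘ₗ LinearMap.mulRight K (Y k)) (χ k • Φ : A →ₗ[K] _)
        (Set.range (pbwMonomial X Y)) := by
      rintro _ ⟨⟨s, t⟩, rfl⟩
      have := hΦ s (t.toList ++ [k])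
      simp only [List.map_append, List.map_singleton, List.prod_append, List.prod_singleton,
        ← mul_assoc] at this
      simp only [pbwMonomial, LinearMap.comp_apply, LinearMap.mulRight_apply, LinearMap.smul_apply,
        hΦ, this, smul_smul, mul_comm]
    exact LinearMap.eqOn_span heq (adjoin_le_span_pbwMonomial hXY hu)
  have hle : Submodule.span K (Set.range fun k => (Y k, χ k)) ≤
      LinearMap.ker (Φ ∘ₗ LinearMap.mulLeft K u ∘ₗ LinearMap.fst K A K -
        LinearMap.toSpanSingleton K _ (Φ u) ∘ₗ LinearMap.snd K A K) := by
    rw [Submodule.span_le]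
    rintro _ ⟨k, rfl⟩
    simp [hY]
  exact sub_eq_zero.mp (hle hz)

theorem linearIndependent_mk_of_linearMap {V ν : Type*} [AddCommGroup V] [Module K V]
    {I : Submodule A A} {f : ν → A} (Φ : A →ₗ[K] V) (hΦ : ∀ u ∈ I, Φ u = 0)
    (hf : LinearIndependent K (Φ ∘ f)) :
    LinearIndependent K fun a => (Submodule.Quotient.mk (f a) : A ⧸ I) :=
  LinearIndependent.of_comp ((I.restrictScalars K).liftQ Φ hΦ ∘ₗ
    (Submodule.Quotient.restrictScalarsEquiv K I).symm.toLinearMap) hf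

end Field

end TriangularDecomposition

section EnvelopingAlgebra

attribute [local instance] LieRing.ofAssociativeRing

variable {K L : Type*} [CommRing K] [LieRing L] [LieAlgebra K L]

theorem commutator_mem_span_of_span_eq_top {A ι : Type*} [Ring A] [Algebra K A] (ρ : L →ₗ⁅K⁆ A)
    {x : ι → L} (hx : Submodule.span K (Set.range x) = ⊤) (i j : ι) :
    ρ (x i) * ρ (x j) - ρ (x j) * ρ (x i) ∈ Submodule.span K (Set.range fun k => ρ (x k)) := by
  rw [← Ring.lie_def, ← LieHom.map_lie, Set.range_comp' ρ x]
  have := Submodule.mem_map_of_mem (f := (ρ : L →ₗ[K] A))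
    (hx ▸ Submodule.mem_top : ⁅x i, x j⁆ ∈ Submodule.span K (Set.range x))
  rwa [Submodule.map_span] at this

theorem adjoin_range_ι_eq_top :
    Algebra.adjoin K (Set.range (UniversalEnvelopingAlgebra.ι K : L → _)) = ⊤ := by
  set S := Algebra.adjoin K (Set.range (UniversalEnvelopingAlgebra.ι K : L → _))
  let f : L →ₗ⁅K⁆ S :=
    { toFun := fun x => ⟨UniversalEnvelopingAlgebra.ι K x, Algebra.subset_adjoin ⟨x, rfl⟩⟩
      map_add' := fun x y => Subtype.ext (map_add _ x y)
      map_smul' := fun c x => Subtype.ext (map_smul _ c x)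
      map_lie' := fun {x y} => Subtype.ext
        (LieHom.map_lie (UniversalEnvelopingAlgebra.ι K) x y) }
  have hretract : S.val.comp (UniversalEnvelopingAlgebra.lift K f) = AlgHom.id K _ := by
    refine UniversalEnvelopingAlgebra.hom_ext K (LieHom.ext fun x => ?_)
    change S.val (UniversalEnvelopingAlgebra.lift K f (UniversalEnvelopingAlgebra.ι K x)) = _
    rw [UniversalEnvelopingAlgebra.lift_ι_apply]
    rfl
  refine eq_top_iff.mpr fun u _ => ?_
  rw [← AlgHom.id_apply (R := K) u, ← hretract]
  exact (UniversalEnvelopingAlgebra.lift K f u).2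

theorem adjoin_range_ι_comp_eq_top {ι : Type*} {x : ι → L}
    (hx : Submodule.span K (Set.range x) = ⊤) :
    Algebra.adjoin K (Set.range fun i => UniversalEnvelopingAlgebra.ι K (x i)) = ⊤ := by
  rw [← Algebra.adjoin_span, Set.range_comp' (UniversalEnvelopingAlgebra.ι K) x]
  have := Submodule.map_span
    (UniversalEnvelopingAlgebra.ι K : L →ₗ⁅K⁆ UniversalEnvelopingAlgebra K L).toLinearMap
    (Set.range x)
  rw [hx, Submodule.map_top] at this
  rw [← adjoin_range_ι_eq_top (K := K) (L := L)]
  exact congrArg _ (congrArg _ this.symm)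

end EnvelopingAlgebra

/-! ### Left invariant differential operators on polynomial functions of matrices -/

section Operators

variable {n R : Type*} [Fintype n] [DecidableEq n] [CommRing R]

variable (n R) in
/-- The generic matrix `g`. The variables of the polynomial ring are the entries of `g - 1`, so that
the identity matrix is the origin. -/
def genericMatrix : Matrix n n (MvPolynomial (n × n) R) := 1 + Matrix.mvPolynomialX n n R

/-- The left invariant vector field of the matrix `M`, which sends the generic matrix `g` to
`g M`. -/
def invariantField (M : Matrix n n R) :
    Derivation R (MvPolynomial (n × n) R) (MvPolynomial (n × n) R) :=
  mkDerivation R fun b => ∑ k, M k b.2 • genericMatrix n R b.1 k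

theorem invariantField_X (M : Matrix n n R) (b : n × n) :
    invariantField M (X b) = ∑ k, M k b.2 • genericMatrix n R b.1 k :=
  mkDerivation_X R _ b

theorem invariantField_genericMatrix (M : Matrix n n R) (i j : n) :
    invariantField M (genericMatrix n R i j) = ∑ k, M k j • genericMatrix n R i k := by
  have hone : (1 : Matrix n n (MvPolynomial (n × n) R)) i j =
      algebraMap R _ ((1 : Matrix n n R) i j) := by
    rw [Matrix.one_apply, Matrix.one_apply]
    split_ifs <;> simp
  rw [genericMatrix, Matrix.add_apply, map_add, hone, Derivation.map_algebraMap, zero_add,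
    Matrix.mvPolynomialX_apply, invariantField_X, genericMatrix]

theorem invariantField_invariantField_X (M N : Matrix n n R) (b : n × n) :
    invariantField M (invariantField N (X b)) = invariantField (M * N) (X b) := by
  simp only [invariantField_X, map_sum, Derivation.map_smul, invariantField_genericMatrix,
    Finset.smul_sum, smul_smul, Matrix.mul_apply, Finset.sum_smul]
  rw [Finset.sum_comm]
  simp only [mul_comm]

attribute [local instance] LieRing.ofAssociativeRing

/-- The representation of `gl_n` by left invariant vector fields. -/
def invariantRep : Matrix n n R →ₗ⁅R⁆ Module.End R (MvPolynomial (n × n) R) where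
  toFun M := (invariantField M : MvPolynomial (n × n) R →ₗ[R] MvPolynomial (n × n) R)
  map_add' M N := by
    rw [← Derivation.coe_add_linearMap]
    congr 1
    refine derivation_ext fun b => ?_
    simp only [Derivation.add_apply, invariantField_X, Matrix.add_apply, add_smul,
      Finset.sum_add_distrib]
  map_smul' c M := by
    rw [RingHom.id_apply, ← Derivation.coe_smul_linearMap]
    congr 1
    refine derivation_ext fun b => ?_
    simp only [Derivation.smul_apply, invariantField_X, Matrix.smul_apply, Finset.smul_sum,
      smul_assoc]
  map_lie' {M N} := by
    rw [← Derivation.commutator_coe_linear_map]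
    congr 1
    refine derivation_ext fun b => ?_
    rw [Derivation.commutator_apply, invariantField_invariantField_X,
      invariantField_invariantField_X]
    simp only [invariantField_X, Ring.lie_def, Matrix.sub_apply, sub_smul, Finset.sum_sub_distrib]

/-- The left invariant vector field of the matrix unit `E_b`, as an operator. -/
def unitOp (b : n × n) : Module.End R (MvPolynomial (n × n) R) :=
  invariantRep (Matrix.single b.1 b.2 1)

theorem invariantRep_eq_sum (M : Matrix n n R) :
    invariantRep M = ∑ b : n × n, M b.1 b.2 • unitOp b := by
  conv_lhs => rw [Matrix.matrix_eq_sum_single M]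
  simp only [map_sum, Fintype.sum_prod_type, unitOp, ← map_smul, Matrix.smul_single, smul_eq_mul,
    mul_one]

theorem invariantField_single (b : n × n) :
    invariantField (Matrix.single b.1 b.2 (1 : R)) =
      ∑ a, genericMatrix n R a b.1 • pderiv (a, b.2) := by
  refine derivation_ext fun c => ?_
  rw [invariantField_X, ← Derivation.coeFnAddMonoidHom_apply, map_sum, Finset.sum_apply]
  have hX (a : n) : pderiv (a, b.2) (X c : MvPolynomial (n × n) R) =
      if c.1 = a then if c.2 = b.2 then 1 else 0 else 0 := by
    simp only [pderiv_X, Pi.single_apply, Prod.ext_iff, ite_and]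
  simp [hX, Matrix.single_apply, ite_and, eq_comm]

theorem unitOp_apply (b : n × n) (F : MvPolynomial (n × n) R) :
    unitOp b F = pderiv b F + ∑ a, X (a, b.1) * pderiv (a, b.2) F := by
  change invariantField (Matrix.single b.1 b.2 (1 : R)) F = _
  rw [invariantField_single, ← Derivation.coeFnAddMonoidHom_apply, map_sum, Finset.sum_apply]
  simp [genericMatrix, Matrix.one_apply, add_mul, Finset.sum_add_distrib]

theorem isHomogeneous_sum_X_mul_pderiv {α σ : Type*} [Fintype α] {F : MvPolynomial σ R} {r : ℕ}
    (hF : F.IsHomogeneous r) (hr : 0 < r) (f g : α → σ) :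
    (∑ a, X (f a) * pderiv (g a) F).IsHomogeneous r := by
  refine IsHomogeneous.sum _ _ _ fun a _ => ?_
  have := (isHomogeneous_X R (f a)).mul (hF.pderiv (i := g a))
  rwa [Nat.add_sub_cancel' hr] at this

theorem constantCoeff_prod_unitOp_of_lt {F : MvPolynomial (n × n) R} {r : ℕ}
    (hF : F.IsHomogeneous r) (l : List (n × n)) (hl : l.length < r) :
    constantCoeff ((l.map unitOp).prod F) = 0 := by
  induction l using List.reverseRecOn generalizing F r with
  | nil =>
    rw [List.map_nil, List.prod_nil, Module.End.one_apply]
    exact hF.coeff_eq_zero (by simpa using hl.ne)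
  | append_singleton l b ih =>
    rw [List.length_append, List.length_singleton] at hl
    rw [List.map_append, List.prod_append, List.map_singleton, List.prod_singleton,
      Module.End.mul_apply, unitOp_apply, map_add, map_add, ih (hF.pderiv (i := b)) (by omega),
      ih (isHomogeneous_sum_X_mul_pderiv hF (by omega) _ _) (by omega), add_zero]

/-- Only the leading term `pderiv b` of the operator `unitOp b` matters in top degree. -/
theorem constantCoeff_prod_unitOp_append {F : MvPolynomial (n × n) R} (l : List (n × n)) (b : n × n)
    (hF : F.IsHomogeneous (l.length + 1)) :
    constantCoeff (((l ++ [b]).map unitOp).prod F) =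
      constantCoeff ((l.map unitOp).prod (pderiv b F)) := by
  rw [List.map_append, List.prod_append, List.map_singleton, List.prod_singleton,
    Module.End.mul_apply, unitOp_apply, map_add, map_add, constantCoeff_prod_unitOp_of_lt
      (isHomogeneous_sum_X_mul_pderiv hF (Nat.succ_pos _) _ _) l (Nat.lt_succ_self _), add_zero]

theorem isHomogeneous_monomial_toFinsupp {σ : Type*} [DecidableEq σ] (s : Multiset σ) (r : R) :
    (monomial (Multiset.toFinsupp s) r).IsHomogeneous s.card := by
  refine isHomogeneous_monomial _ ?_
  exact Multiset.toFinsupp_sum_eq s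

theorem pderiv_monomial_toFinsupp_cons {σ : Type*} [DecidableEq σ] (b : σ) (s : Multiset σ) :
    pderiv b (monomial (Multiset.toFinsupp (b ::ₘ s)) (1 : R)) =
      (s.count b + 1 : R) • monomial (Multiset.toFinsupp s) 1 := by
  rw [pderiv_monomial, ← Multiset.singleton_add, map_add, Multiset.toFinsupp_singleton,
    add_tsub_cancel_left, smul_monomial]
  simp [add_comm]

theorem constantCoeff_prod_unitOp_monomial_ne_zero_iff [IsDomain R] [CharZero R]
    (l : List (n × n)) (s : Multiset (n × n)) (hs : s.card = l.length) :
    constantCoeff ((l.map unitOp).prod (monomial (Multiset.toFinsupp s) (1 : R))) ≠ 0 ↔ s = l := by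
  induction l using List.reverseRecOn generalizing s with
  | nil =>
    obtain rfl : s = 0 := by simpa using hs
    simp
  | append_singleton l b ih =>
    rw [List.length_append, List.length_singleton] at hs
    rw [constantCoeff_prod_unitOp_append l b (hs ▸ isHomogeneous_monomial_toFinsupp s 1),
      ← Multiset.coe_add, Multiset.coe_singleton, add_comm, Multiset.singleton_add]
    by_cases hb : b ∈ s
    · obtain ⟨t, rfl⟩ := Multiset.exists_cons_of_mem hb
      rw [pderiv_monomial_toFinsupp_cons, map_smul, constantCoeff_smul, smul_eq_mul,
        mul_ne_zero_iff, and_iff_right (Nat.cast_add_one_ne_zero _), ih t (by simpa using hs),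
        Multiset.cons_inj_right]
    · have hzero : Multiset.toFinsupp s b = 0 := by simpa using hb
      rw [pderiv_monomial, hzero, Nat.cast_zero, mul_zero, map_zero, map_zero, map_zero]
      simp only [ne_eq, not_true_eq_false, false_iff]
      rintro rfl
      exact hb (Multiset.mem_cons_self b _)

theorem linearIndependent_prod_unitOp [IsDomain R] [CharZero R] {κ : Type*}
    (f : κ → List (n × n)) (hf : Function.Injective fun a => (f a : Multiset (n × n))) :
    LinearIndependent R fun a => ((f a).map (unitOp (R := R))).prod := by
  rw [linearIndependent_iff]
  intro c hc
  by_contra h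
  obtain ⟨a₀, ha₀, hmax⟩ := Finset.exists_max_image c.support (fun a => (f a).length)
    (Finsupp.support_nonempty_iff.mpr h)
  set F : MvPolynomial (n × n) R := monomial (Multiset.toFinsupp (f a₀ : Multiset (n × n))) 1
  have hzero := congrArg (fun T : Module.End R _ => constantCoeff (T F)) hc
  simp only [Finsupp.linearCombination_apply, Finsupp.sum, LinearMap.sum_apply, map_sum,
    LinearMap.smul_apply, constantCoeff_smul, smul_eq_mul, LinearMap.zero_apply, map_zero] at hzero
  rw [Finset.sum_eq_single_of_mem a₀ ha₀] at hzero
  · exact mul_ne_zero (Finsupp.mem_support_iff.mp ha₀)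
      ((constantCoeff_prod_unitOp_monomial_ne_zero_iff _ _ rfl).mpr rfl) hzero
  · intro a ha hne
    refine mul_eq_zero_of_right _ ?_
    rcases (hmax a ha).lt_or_eq with hlt | heq
    · exact constantCoeff_prod_unitOp_of_lt (isHomogeneous_monomial_toFinsupp _ _) _ hlt
    · by_contra h0
      exact hne (hf
        ((constantCoeff_prod_unitOp_monomial_ne_zero_iff (f a) (f a₀) heq.symm).mp h0).symm)

end Operators

/-! ### Bases of Verma modules -/

section UpperTriangular

variable {n R : Type*} [Fintype n] [LinearOrder n]

theorem mul_apply_self_of_blockTriangular [CommRing R] {M N : Matrix n n R}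
    (hM : M.BlockTriangular id) (hN : N.BlockTriangular id) (i : n) :
    (M * N) i i = M i i * N i i := by
  rw [Matrix.mul_apply, Finset.sum_eq_single_of_mem i (Finset.mem_univ i)]
  intro k _ hk
  rcases hk.lt_or_gt with h | h
  · rw [hM h, zero_mul]
  · rw [hN h, mul_zero]

end UpperTriangular

section BorelOperators

variable {m : ℕ}

/-- The positions of the upper triangular matrix units. They index a basis of the Borel subalgebra
of `gl_m`, the complement of `NegRoot m`. -/
abbrev BorelIndex (m : ℕ) := {p : Fin m × Fin m // p.1 ≤ p.2}

/-- The vector fields of the strictly lower triangular matrix units. -/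
def negOp (p : NegRoot m) : Module.End ℂ (MvPolynomial (Fin m × Fin m) ℂ) := unitOp p.1

/-- The vector fields of the upper triangular matrix units. -/
def borelOp (p : BorelIndex m) : Module.End ℂ (MvPolynomial (Fin m × Fin m) ℂ) := unitOp p.1

/-- The character of the upper triangular matrices with diagonal values `w`, on matrix units. -/
def borelChar (w : Fin m → ℂ) (p : BorelIndex m) : ℂ := if p.1.1 = p.1.2 then w p.1.1 else 0

theorem map_val_add_map_val_injective {α : Type*} {P Q : α → Prop} (hPQ : ∀ x, P x → ¬ Q x) :
    Function.Injective fun a : Multiset {x // P x} × Multiset {x // Q x} =>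
      a.1.map Subtype.val + a.2.map Subtype.val := by
  classical
  have hfst (s : Multiset {x // P x}) (t : Multiset {x // Q x}) :
      (s.map Subtype.val + t.map Subtype.val).filter P = s.map Subtype.val := by
    rw [Multiset.filter_add, Multiset.filter_eq_self.mpr, Multiset.filter_eq_nil.mpr, add_zero]
    · intro x hx hP
      obtain ⟨y, -, rfl⟩ := Multiset.mem_map.mp hx
      exact hPQ y hP y.2
    · intro x hx
      obtain ⟨y, -, rfl⟩ := Multiset.mem_map.mp hx
      exact y.2
  rintro ⟨s, t⟩ ⟨s', t'⟩ h
  have hs : s.map Subtype.val = s'.map Subtype.val := by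
    rw [← hfst s t, ← hfst s' t']
    exact congrArg _ h
  have ht : t.map Subtype.val = t'.map Subtype.val := by
    simpa only [hs, add_right_inj] using h
  exact Prod.ext (Multiset.map_injective Subtype.val_injective hs)
    (Multiset.map_injective Subtype.val_injective ht)

theorem linearIndependent_pbwMonomial_negOp_borelOp :
    LinearIndependent ℂ (pbwMonomial (negOp (m := m)) borelOp) := by
  have hmonomial : pbwMonomial (negOp (m := m)) borelOp = fun a =>
      ((a.1.toList.map Subtype.val ++ a.2.toList.map Subtype.val).map unitOp).prod := by
    funext a
    simp only [pbwMonomial, List.map_append, List.prod_append, List.map_map]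
    rfl
  rw [hmonomial]
  refine linearIndependent_prod_unitOp _ ?_
  convert map_val_add_map_val_injective (α := Fin m × Fin m) (P := fun p => p.2 < p.1)
    (Q := fun p => p.1 ≤ p.2) (fun p => not_le.mpr) using 2 with a
  rw [← Multiset.coe_add, ← Multiset.map_coe, ← Multiset.map_coe, Multiset.coe_toList,
    Multiset.coe_toList]

attribute [local instance] LieRing.ofAssociativeRing

theorem invariantRep_mem_span_range_sumElim (M : Matrix (Fin m) (Fin m) ℂ) :
    invariantRep M ∈ Submodule.span ℂ (Set.range (Sum.elim (negOp (m := m)) borelOp)) := by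
  rw [invariantRep_eq_sum]
  refine sum_mem fun b _ => Submodule.smul_mem _ _ (Submodule.subset_span ?_)
  rcases lt_or_ge b.2 b.1 with h | h
  · exact ⟨Sum.inl ⟨b, h⟩, rfl⟩
  · exact ⟨Sum.inr ⟨b, h⟩, rfl⟩

theorem sumElim_commutator_mem_span (i j : NegRoot m ⊕ BorelIndex m) :
    Sum.elim negOp borelOp i * Sum.elim negOp borelOp j -
        Sum.elim negOp borelOp j * Sum.elim negOp borelOp i ∈
      Submodule.span ℂ (Set.range (Sum.elim (negOp (m := m)) borelOp)) := by
  have h (i : NegRoot m ⊕ BorelIndex m) :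
      ∃ M : Matrix (Fin m) (Fin m) ℂ, Sum.elim negOp borelOp i = invariantRep M := by
    rcases i with p | p <;> exact ⟨_, rfl⟩
  obtain ⟨⟨M, hM⟩, ⟨N, hN⟩⟩ := And.intro (h i) (h j)
  rw [hM, hN, ← Ring.lie_def, ← LieHom.map_lie]
  exact invariantRep_mem_span_range_sumElim _

theorem invariantRep_mem_span_borelOp (w : Fin m → ℂ) {M : Matrix (Fin m) (Fin m) ℂ}
    (hM : M.BlockTriangular id) : (invariantRep M, ∑ i, M i i * w i) ∈
      Submodule.span ℂ (Set.range fun p => (borelOp p, borelChar w p)) := by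
  have hsum : (invariantRep M, ∑ i, M i i * w i) =
      ∑ b : Fin m × Fin m, M b.1 b.2 • (unitOp b, if b.1 = b.2 then w b.1 else 0) := by
    ext1
    · rw [Prod.fst_sum, invariantRep_eq_sum]
      rfl
    · simp [Prod.snd_sum, Fintype.sum_prod_type]
  rw [hsum]
  refine sum_mem fun b _ => ?_
  rcases lt_or_ge b.2 b.1 with h | h
  · rw [hM h, zero_smul]
    exact zero_mem _
  · exact Submodule.smul_mem _ _ (Submodule.subset_span ⟨⟨b, h⟩, rfl⟩)

/-- The commutator of two upper triangular matrices has zero diagonal, so every choice of diagonal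
values defines a character. -/
theorem invariantRep_commutator_mem_span_borelOp (w : Fin m → ℂ) {M N : Matrix (Fin m) (Fin m) ℂ}
    (hM : M.BlockTriangular id) (hN : N.BlockTriangular id) :
    (invariantRep M * invariantRep N - invariantRep N * invariantRep M, (0 : ℂ)) ∈
      Submodule.span ℂ (Set.range fun p => (borelOp p, borelChar w p)) := by
  have h := invariantRep_mem_span_borelOp w ((hM.mul hN).sub (hN.mul hM))
  have hdiag (i : Fin m) : (M * N - N * M) i i = 0 := by
    rw [Matrix.sub_apply, mul_apply_self_of_blockTriangular hM hN,
      mul_apply_self_of_blockTriangular hN hM, mul_comm, sub_self]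
  simp only [hdiag, zero_mul, Finset.sum_const_zero] at h
  rwa [← Ring.lie_def, LieHom.map_lie] at h

theorem borelOp_commutator_mem_span (w : Fin m → ℂ) (a b : BorelIndex m) :
    (borelOp a * borelOp b - borelOp b * borelOp a, (0 : ℂ)) ∈
      Submodule.span ℂ (Set.range fun p => (borelOp p, borelChar w p)) := by
  have htri (p : BorelIndex m) :
      (Matrix.single p.1.1 p.1.2 (1 : ℂ)).BlockTriangular id := fun i j hij => by
    refine Matrix.single_apply_of_ne _ _ _ _ _ ?_
    rintro ⟨rfl, rfl⟩
    exact hij.not_ge p.2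
  exact invariantRep_commutator_mem_span_borelOp w (htri a) (htri b)

end BorelOperators

section EnvelopingRep

variable {m : ℕ}

attribute [local instance] LieRing.ofAssociativeRing

/-- The action of the enveloping algebra of `sl_m` by left invariant differential operators. -/
def envelopingRep (m : ℕ) : U m →ₐ[ℂ] Module.End ℂ (MvPolynomial (Fin m × Fin m) ℂ) :=
  UniversalEnvelopingAlgebra.lift ℂ
    (invariantRep.comp (LieAlgebra.SpecialLinear.sl (Fin m) ℂ).incl)

theorem envelopingRep_toU (x : SL m) : envelopingRep m (toU x) = invariantRep x.val :=
  UniversalEnvelopingAlgebra.lift_ι_apply ℂ _ x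

theorem envelopingRep_mem_adjoin (u : U m) :
    envelopingRep m u ∈ Algebra.adjoin ℂ (Set.range (Sum.elim (negOp (m := m)) borelOp)) := by
  have hu : envelopingRep m u ∈ (⊤ : Subalgebra ℂ (U m)).map (envelopingRep m) :=
    ⟨u, Algebra.mem_top, rfl⟩
  rw [← adjoin_range_ι_eq_top, AlgHom.map_adjoin] at hu
  refine Algebra.adjoin_le ?_ hu
  rintro _ ⟨_, ⟨x, rfl⟩, rfl⟩
  have hx : envelopingRep m (UniversalEnvelopingAlgebra.ι ℂ x) = invariantRep x.val :=
    envelopingRep_toU x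
  rw [hx]
  exact Algebra.span_le_adjoin ℂ _ (invariantRep_mem_span_range_sumElim _)

theorem exists_forall_eq_sum_diag (lam : Module.Dual ℂ (cartan m)) :
    ∃ w : Fin m → ℂ, ∀ h : cartan m, lam h = ∑ i, h.val.val i i * w i := by
  let diag : cartan m →ₗ[ℂ] Fin m → ℂ :=
    Matrix.diagLinearMap (Fin m) ℂ ℂ ∘ₗ
      (LieAlgebra.SpecialLinear.sl (Fin m) ℂ).toSubmodule.subtype ∘ₗ (cartan m).subtype
  have hinj : LinearMap.ker diag = ⊥ := by
    rw [LinearMap.ker_eq_bot]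
    intro h h' hh
    ext i j
    by_cases hij : i = j
    · subst hij
      exact congrFun hh i
    · exact (h.2 hij).trans (h'.2 hij).symm
  obtain ⟨g, hg⟩ := diag.exists_leftInverse_of_injective hinj
  refine ⟨fun i => lam (g fun j => if i = j then 1 else 0), fun h => ?_⟩
  have hh : lam h = (lam ∘ₗ g) (diag h) :=
    congrArg lam (LinearMap.congr_fun hg h).symm
  rw [hh, LinearMap.pi_apply_eq_sum_univ]
  rfl

/-- The strictly lower triangular matrix units, as elements of `sl_m`. -/
def negElt (p : NegRoot m) : SL m := LieAlgebra.SpecialLinear.single p.1.1 p.1.2 p.2.ne' 1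

/-- The strictly lower triangular matrix units, as elements of the enveloping algebra. -/
def negU (p : NegRoot m) : U m := toU (negElt p)

theorem envelopingRep_negU (p : NegRoot m) : envelopingRep m (negU p) = negOp p :=
  envelopingRep_toU _

theorem map_eq_zero_of_mem_vermaIdeal {lam : Module.Dual ℂ (cartan m)} {w : Fin m → ℂ}
    (hw : ∀ h : cartan m, lam h = ∑ i, h.val.val i i * w i) {V : Type*} [AddCommGroup V]
    [Module ℂ V] {Φ : U m →ₗ[ℂ] V}
    (hΦ : ∀ (u : U m) (x : SL m), x.val.BlockTriangular id →
      Φ (u * toU x) = (∑ i, x.val i i * w i) • Φ u) :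
    ∀ x ∈ vermaIdeal lam, Φ x = 0 := by
  suffices hle : ∀ x ∈ vermaIdeal lam, ∀ u : U m, Φ (u * x) = 0 from fun x hx => by
    simpa using hle x hx 1
  intro x hx
  induction hx using Submodule.span_induction with
  | mem x hx =>
    intro u
    rcases hx with ⟨y, hy, rfl⟩ | ⟨h, rfl⟩
    · rw [hΦ u y fun i j hij => hy i j hij.le, Finset.sum_eq_zero, zero_smul]
      intro i _
      rw [hy i i le_rfl, zero_mul]
    · rw [mul_sub, map_sub, hΦ u h.val fun i j hij => h.2 hij.ne', ← hw,
        ← Algebra.commutes, ← Algebra.smul_def, map_smul, sub_self]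
  | zero => simp
  | add x y _ _ hx hy => intro u; rw [mul_add, map_add, hx, hy, add_zero]
  | smul a x _ hx => intro u; rw [smul_eq_mul, ← mul_assoc]; exact hx _

/-- The products of strictly lower triangular matrix units, applied to the highest weight
vector. -/
def vermaVector (lam : Module.Dual ℂ (cartan m)) (s : Multiset (NegRoot m)) : Verma lam :=
  (s.toList.map negU).prod • Submodule.Quotient.mk 1

theorem linearIndependent_vermaVector (lam : Module.Dual ℂ (cartan m)) :
    LinearIndependent ℂ (vermaVector lam) := by
  obtain ⟨w, hw⟩ := exists_forall_eq_sum_diag lam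
  obtain ⟨Φ, hsingle, hΦ⟩ := exists_linearMap_mul_eq_smul
    linearIndependent_pbwMonomial_negOp_borelOp sumElim_commutator_mem_span
    (borelOp_commutator_mem_span w)
  have hker := map_eq_zero_of_mem_vermaIdeal hw (Φ := Φ ∘ₗ (envelopingRep m).toLinearMap)
    fun u x hx => by
      rw [LinearMap.comp_apply, AlgHom.toLinearMap_apply, map_mul, envelopingRep_toU]
      exact hΦ _ (envelopingRep_mem_adjoin u) _ (invariantRep_mem_span_borelOp w hx)
  have hvector : vermaVector lam = fun s => Submodule.Quotient.mk (s.toList.map negU).prod := by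
    funext s
    rw [vermaVector, ← Submodule.Quotient.mk_smul, smul_eq_mul, mul_one]
  have hbasis : (Φ ∘ₗ (envelopingRep m).toLinearMap) ∘
      (fun s : Multiset (NegRoot m) => (s.toList.map negU).prod) =
      fun s => Finsupp.single s 1 := by
    funext s
    simp [map_list_prod, Function.comp_def, envelopingRep_negU, hsingle]
  rw [hvector]
  refine linearIndependent_mk_of_linearMap _ hker ?_
  rw [hbasis]
  exact Finsupp.linearIndependent_single_one ℂ _

end EnvelopingRep

section Spanning

variable {m : ℕ}

attribute [local instance] LieRing.ofAssociativeRing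

/-- The diagonal part of a traceless matrix. -/
def diagPart (x : SL m) : cartan m :=
  ⟨⟨Matrix.diagonal x.val.diag, by
    have : ∑ i, x.val i i = 0 := x.2
    change Matrix.trace (Matrix.diagonal x.val.diag) = 0
    rw [Matrix.trace_diagonal]
    exact this⟩, Matrix.isDiag_diagonal _⟩

theorem cartan_smul_mk_one (lam : Module.Dual ℂ (cartan m)) (h : cartan m) :
    toU h.val • (Submodule.Quotient.mk 1 : Verma lam) = lam h • Submodule.Quotient.mk 1 := by
  rw [← Submodule.Quotient.mk_smul, ← Submodule.Quotient.mk_smul, Submodule.Quotient.eq,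
    smul_eq_mul, mul_one, ← Algebra.algebraMap_eq_smul_one]
  exact Submodule.subset_span (Or.inr ⟨h, rfl⟩)

theorem toU_smul_mk_one (lam : Module.Dual ℂ (cartan m)) {x : SL m}
    (hx : x.val.BlockTriangular id) :
    toU x • (Submodule.Quotient.mk 1 : Verma lam) =
      lam (diagPart x) • Submodule.Quotient.mk 1 := by
  have hstrict : toU (x - (diagPart x).val) ∈ vermaIdeal lam := by
    refine Submodule.subset_span (Or.inl ⟨_, fun i j hij => ?_, rfl⟩)
    change x.val i j - Matrix.diagonal x.val.diag i j = 0
    rcases hij.lt_or_eq with h | rfl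
    · rw [hx h, Matrix.diagonal_apply_ne _ h.ne', sub_zero]
    · rw [Matrix.diagonal_apply_eq, Matrix.diag_apply, sub_self]
  rw [← cartan_smul_mk_one, ← Submodule.Quotient.mk_smul, ← Submodule.Quotient.mk_smul,
    Submodule.Quotient.eq, smul_eq_mul, smul_eq_mul, mul_one, mul_one]
  rwa [toU, map_sub] at hstrict

/-- The upper triangular traceless matrices, a spanning set of the Borel subalgebra. -/
abbrev UpperElt (m : ℕ) := {x : SL m // x.val.BlockTriangular id}

theorem span_range_negElt_upperElt :
    Submodule.span ℂ (Set.range (Sum.elim (negElt (m := m)) (Subtype.val : UpperElt m → SL m))) =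
      ⊤ := by
  rw [eq_top_iff]
  intro x _
  set y : SL m := ∑ p : NegRoot m, x.val p.1.1 p.1.2 • negElt p
  have hlower : (x - y).val.BlockTriangular id := by
    intro i j hij
    have hyv : y.val = ∑ p : NegRoot m, x.val p.1.1 p.1.2 •
        (Matrix.single p.1.1 p.1.2 1 : Matrix (Fin m) (Fin m) ℂ) :=
      map_sum (LieAlgebra.SpecialLinear.sl (Fin m) ℂ).toSubmodule.subtype _ _
    have hyij : y.val i j = x.val i j := by
      rw [hyv, Matrix.sum_apply, Finset.sum_eq_single_of_mem ⟨(i, j), hij⟩ (Finset.mem_univ _)]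
      · simp
      · rintro ⟨⟨a, b⟩, hab⟩ _ hne
        rw [Matrix.smul_apply, Matrix.single_apply_of_ne, smul_zero]
        rintro ⟨rfl, rfl⟩
        exact hne rfl
    exact sub_eq_zero.mpr hyij.symm
  rw [← sub_add_cancel x y]
  refine add_mem (Submodule.subset_span ⟨Sum.inr ⟨x - y, hlower⟩, rfl⟩) ?_
  exact sum_mem fun p _ => Submodule.smul_mem _ _ (Submodule.subset_span ⟨Sum.inl p, rfl⟩)

theorem span_range_vermaVector (lam : Module.Dual ℂ (cartan m)) :
    Submodule.span ℂ (Set.range (vermaVector lam)) = ⊤ := by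
  have helim : Sum.elim (negU (m := m)) (fun x : UpperElt m => toU x.val) =
      fun i => UniversalEnvelopingAlgebra.ι ℂ (Sum.elim negElt Subtype.val i) := by
    funext i
    rcases i with p | x <;> rfl
  refine span_range_prod_smul_eq_top (X := negU) (Y := fun x : UpperElt m => toU x.val)
    (χ := fun x => lam (diagPart x.val)) ?_ ?_ ?_ fun x => toU_smul_mk_one lam x.2
  · rw [helim]
    exact commutator_mem_span_of_span_eq_top _ span_range_negElt_upperElt
  · rw [helim]
    exact adjoin_range_ι_comp_eq_top span_range_negElt_upperElt
  · rw [Submodule.eq_top_iff']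
    intro v
    obtain ⟨u, rfl⟩ := Submodule.Quotient.mk_surjective _ v
    exact Submodule.mem_span_singleton.mpr ⟨u, by
      rw [← Submodule.Quotient.mk_smul, smul_eq_mul, mul_one]⟩

/-- The basis of a Verma module given by the ordered products of strictly lower triangular matrix
units, indexed by the families of exponents. -/
def vermaBasis (lam : Module.Dual ℂ (cartan m)) :
    Module.Basis (NegRoot m → ℕ) ℂ (Verma lam) :=
  (Module.Basis.mk (linearIndependent_vermaVector lam) (span_range_vermaVector lam).ge).reindex
    (Multiset.toFinsupp.toEquiv.trans Finsupp.equivFunOnFinite)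

theorem exists_vermaBasis_eq (lam : Module.Dual ℂ (cartan m)) (k : NegRoot m → ℕ) :
    ∃ s : Multiset (NegRoot m), (∀ p, s.count p = k p) ∧ vermaBasis lam k = vermaVector lam s := by
  obtain ⟨s, rfl⟩ := (Multiset.toFinsupp.toEquiv.trans Finsupp.equivFunOnFinite).surjective k
  refine ⟨s, fun p => rfl, ?_⟩
  rw [vermaBasis, Module.Basis.reindex_apply, Equiv.symm_apply_apply, Module.Basis.mk_apply]

end Spanning

/-! ### Weight spaces -/

theorem mem_span_image_of_forall_apply_eq_smul {K V ι H : Type*} [Field K] [AddCommGroup V]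
    [Module K V] (b : Module.Basis ι K V) {T : H → Module.End K V} {χ : ι → H → K}
    (hb : ∀ i h, T h (b i) = χ i h • b i) {μ : H → K} {v : V} (hv : ∀ h, T h v = μ h • v) :
    v ∈ Submodule.span K (b '' {i | χ i = μ}) := by
  refine b.mem_span_image.mpr fun i hi => funext fun h => ?_
  have hcoord : b.coord i ∘ₗ T h = χ i h • b.coord i := b.ext fun j => by
    rw [LinearMap.comp_apply, hb, map_smul, LinearMap.smul_apply, b.coord_apply, b.repr_self,
      smul_eq_mul, smul_eq_mul]
    by_cases hij : i = j
    · rw [hij]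
    · rw [Finsupp.single_eq_of_ne hij, mul_zero, mul_zero]
  have hv' := LinearMap.congr_fun hcoord v
  rw [LinearMap.comp_apply, hv, map_smul] at hv'
  exact (mul_right_cancel₀ (Finsupp.mem_support_iff.mp hi) hv').symm

section Weights

variable {m : ℕ}

theorem weightOf_zero : weightOf (0 : Fin m → ℤ) = 0 := by
  ext h
  simp [weightOf]

theorem weightOf_add (ν ν' : Fin m → ℤ) : weightOf (ν + ν') = weightOf ν + weightOf ν' := by
  ext h
  simp [weightOf, add_mul, Finset.sum_add_distrib]

theorem weightOf_rootVec (p : Fin m × Fin m) (h : cartan m) :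
    weightOf (rootVec p) h = h.val.val p.1 p.1 - h.val.val p.2 p.2 := by
  change ∑ i, ((rootVec p i : ℤ) : ℂ) * h.val.val i i = _
  simp [rootVec, Pi.single_apply, sub_mul, Finset.sum_sub_distrib]

theorem weightOf_coroot (ν : Fin m → ℤ) (i j : Fin m) :
    weightOf ν (coroot m i j) = ((ν i - ν j : ℤ) : ℂ) := by
  change ∑ l, (ν l : ℂ) *
    (Matrix.single i i (1 : ℂ) - Matrix.single j j 1 : Matrix (Fin m) (Fin m) ℂ) l l = _
  simp [Matrix.single_apply, mul_sub, Finset.sum_sub_distrib]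

theorem weightOf_injOn : Set.InjOn (weightOf (m := m)) {ν | ∑ i, ν i = 0} := by
  intro ν hν ν' hν' h
  have hdiff : ∀ i j, ν i - ν j = ν' i - ν' j := fun i j => by
    have := DFunLike.congr_fun h (coroot m i j)
    rw [weightOf_coroot, weightOf_coroot] at this
    exact_mod_cast this
  funext i
  have hsum := Finset.sum_congr rfl fun j (_ : j ∈ Finset.univ) => hdiff i j
  simp only [Finset.sum_sub_distrib, hν.out, hν'.out, Finset.sum_const, Finset.card_univ,
    Fintype.card_fin, nsmul_eq_mul, sub_zero] at hsum
  exact mul_left_cancel₀ (Nat.cast_ne_zero.mpr i.pos.ne') hsum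

theorem diagonal_mul_single_sub {n R : Type*} [Fintype n] [DecidableEq n] [CommRing R] (d : n → R)
    (i j : n) : Matrix.diagonal d * Matrix.single i j 1 - Matrix.single i j 1 * Matrix.diagonal d =
      (d i - d j) • Matrix.single i j 1 := by
  ext a b
  rw [Matrix.sub_apply, Matrix.diagonal_mul, Matrix.mul_diagonal, Matrix.smul_apply,
    mul_comm _ (d b), ← sub_mul, smul_eq_mul, Matrix.single_apply]
  split_ifs with hab
  · rw [hab.1, hab.2]
  · rw [mul_zero, mul_zero]

theorem lie_negElt (h : cartan m) (p : NegRoot m) :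
    ⁅h.val, negElt p⁆ = weightOf (rootVec p.1) h • negElt p := by
  obtain ⟨d, hd⟩ : ∃ d, h.val.val = Matrix.diagonal d :=
    ⟨_, ((Matrix.isDiag_iff_diagonal_diag _).mp h.2).symm⟩
  rw [weightOf_rootVec, hd, Matrix.diagonal_apply_eq, Matrix.diagonal_apply_eq]
  apply Subtype.ext
  rw [LieAlgebra.SpecialLinear.sl_bracket, hd]
  exact diagonal_mul_single_sub d p.1.1 p.1.2

attribute [local instance] LieRing.ofAssociativeRing

theorem toU_mul_negU (h : cartan m) (p : NegRoot m) :
    toU h.val * negU p = negU p * toU h.val + weightOf (rootVec p.1) h • negU p := by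
  have hlie := congrArg (UniversalEnvelopingAlgebra.ι ℂ) (lie_negElt h p)
  rw [LieHom.map_lie, map_smul, Ring.lie_def, sub_eq_iff_eq_add'] at hlie
  exact hlie

theorem toU_smul_prod_negU_smul_mk_one (lam : Module.Dual ℂ (cartan m)) (h : cartan m)
    (l : List (NegRoot m)) :
    toU h.val • (l.map negU).prod • (Submodule.Quotient.mk 1 : Verma lam) =
      (lam + weightOf (l.map fun p => rootVec p.1).sum) h •
        (l.map negU).prod • Submodule.Quotient.mk 1 := by
  induction l with
  | nil =>
    rw [List.map_nil, List.prod_nil, one_smul, cartan_smul_mk_one, List.map_nil, List.sum_nil,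
      weightOf_zero, add_zero]
  | cons p l ih =>
    rw [List.map_cons, List.prod_cons, mul_smul, ← mul_smul (toU h.val), toU_mul_negU, add_smul,
      mul_smul, ih, smul_comm (negU p), smul_assoc, ← add_smul, List.map_cons, List.sum_cons,
      weightOf_add, add_left_comm lam, LinearMap.add_apply (weightOf _), add_comm]

theorem rootSum_count (s : Multiset (NegRoot m)) :
    rootSum m (fun p => s.count p) = (s.map fun p => rootVec p.1).sum := by
  rw [rootSum, Fintype.linearCombination_apply, Finset.sum_multiset_map_count]
  symm
  refine Finset.sum_subset (Finset.subset_univ _) fun p _ hp => ?_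
  rw [Multiset.count_eq_zero.mpr (by simpa using hp), zero_smul]

theorem toU_smul_vermaBasis (lam : Module.Dual ℂ (cartan m)) (k : NegRoot m → ℕ) (h : cartan m) :
    toU h.val • vermaBasis lam k = (lam + weightOf (rootSum m k)) h • vermaBasis lam k := by
  obtain ⟨s, hs, hk⟩ := exists_vermaBasis_eq lam k
  rw [hk, vermaVector, toU_smul_prod_negU_smul_mk_one, ← funext hs, rootSum_count,
    ← Multiset.sum_coe, ← Multiset.map_coe, Multiset.coe_toList]

theorem weightSpace_eq_span (lam μ : Module.Dual ℂ (cartan m)) :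
    weightSpace lam μ =
      Submodule.span ℂ (vermaBasis lam '' {k | lam + weightOf (rootSum m k) = μ}) := by
  apply le_antisymm
  · intro v hv
    have := mem_span_image_of_forall_apply_eq_smul (vermaBasis lam)
      (T := fun h : cartan m => Algebra.lsmul ℂ ℂ (Verma lam) (toU h.val))
      (χ := fun k => ⇑(lam + weightOf (rootSum m k))) (toU_smul_vermaBasis lam) (μ := μ) hv
    simpa only [DFunLike.coe_fn_eq] using this
  · rw [Submodule.span_le]
    rintro _ ⟨k, rfl, rfl⟩ h
    exact toU_smul_vermaBasis lam k h

theorem setOf_add_weightOf_rootSum_eq (lam : Module.Dual ℂ (cartan m)) {ν : Fin m → ℤ}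
    (hν : ∑ i, ν i = 0) :
    {k | lam + weightOf (rootSum m k) = lam + weightOf ν} = {k | rootSum m k = ν} := by
  ext k
  exact (add_right_inj lam).trans (weightOf_injOn.eq_iff (sum_rootSum k) hν)

theorem exists_of_weightSpace_ne_bot {lam μ : Module.Dual ℂ (cartan m)}
    (h : weightSpace lam μ ≠ ⊥) : ∃ k, μ = lam + weightOf (rootSum m k) := by
  contrapose! h
  have hempty : {k | lam + weightOf (rootSum m k) = μ} = ∅ :=
    Set.eq_empty_of_forall_notMem fun k hk => h k hk.symm
  rw [weightSpace_eq_span, hempty, Set.image_empty, Submodule.span_empty]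

theorem finiteDimensional_weightSpace (lam μ : Module.Dual ℂ (cartan m)) :
    FiniteDimensional ℂ (weightSpace lam μ) := by
  by_cases h : weightSpace lam μ = ⊥
  · rw [h]
    infer_instance
  · obtain ⟨k, rfl⟩ := exists_of_weightSpace_ne_bot h
    rw [weightSpace_eq_span, setOf_add_weightOf_rootSum_eq lam (sum_rootSum k)]
    have hfin : {k' | rootSum m k' = rootSum m k}.Finite := finite_rootSum_fiber _
    exact FiniteDimensional.span_of_finite ℂ (hfin.image _)

theorem finrank_weightSpace (lam : Module.Dual ℂ (cartan m)) {ν : Fin m → ℤ}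
    (hν : ∑ i, ν i = 0) :
    Module.finrank ℂ (weightSpace lam (lam + weightOf ν)) =
      Nat.card {k // rootSum m k = ν} := by
  rw [weightSpace_eq_span, setOf_add_weightOf_rootSum_eq lam hν, Set.image_eq_range]
  exact Module.finrank_eq_nat_card_basis (Module.Basis.span
    ((vermaBasis lam).linearIndependent.comp _ Subtype.val_injective))

theorem shiftedCharacter_eq_geometricProduct (lam : Module.Dual ℂ (cartan m)) :
    shiftedCharacter lam = geometricProduct m := by
  funext ν
  rw [shiftedCharacter]
  split_ifs with hν
  · rw [finrank_weightSpace lam hν, geometricProduct_eq_card]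
  · by_contra h
    exact hν (geometricProduct_ne_zero_iff.mp (Ne.symm h)).1

end Weights

end VermaLorentzian

end

theorem mainTheorem8_general (m : ℕ) (lam : Module.Dual ℂ (VermaLorentzian.cartan m)) :
    (∀ μ : Module.Dual ℂ (VermaLorentzian.cartan m),
      FiniteDimensional ℂ (VermaLorentzian.weightSpace lam μ) ∧
      (VermaLorentzian.weightSpace lam μ ≠ ⊥ →
        ∃ ν : Fin m → ℤ, ∑ i, ν i = 0 ∧ μ = lam + VermaLorentzian.weightOf ν)) ∧
    VermaLorentzian.shiftedCharacter lam = VermaLorentzian.geometricProduct m ∧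
    ∀ δ : Fin m → ℕ, ∃ p : MvPolynomial (Fin m) ℝ,
      (p : MvPowerSeries (Fin m) ℝ) =
        ((VermaLorentzian.shiftedCharacter lam).monomialMul δ).normalize ∧
      VermaLorentzian.IsLorentzian p := by
  refine ⟨fun μ => ⟨VermaLorentzian.finiteDimensional_weightSpace lam μ, fun hμ => ?_⟩,
    VermaLorentzian.shiftedCharacter_eq_geometricProduct lam, fun δ => ?_⟩
  · obtain ⟨k, hk⟩ := VermaLorentzian.exists_of_weightSpace_ne_bot hμ
    exact ⟨_, VermaLorentzian.sum_rootSum k, hk⟩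
  · rw [VermaLorentzian.shiftedCharacter_eq_geometricProduct]
    exact VermaLorentzian.exists_isLorentzian_normalize δ

theorem mainTheorem8 (m : ℕ) (lam : Module.Dual ℂ (VermaLorentzian.cartan m))
    (hlam : lam ∈ VermaLorentzian.weightLattice m) :
    (∀ μ ∈ VermaLorentzian.weightLattice m,
      FiniteDimensional ℂ (VermaLorentzian.weightSpace lam μ) ∧
      (VermaLorentzian.weightSpace lam μ ≠ ⊥ →
        ∃ ν : Fin m → ℤ, ∑ i, ν i = 0 ∧ μ = lam + VermaLorentzian.weightOf ν)) ∧
    VermaLorentzian.shiftedCharacter lam = VermaLorentzian.geometricProduct m ∧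
    ∀ δ : Fin m → ℕ, ∃ p : MvPolynomial (Fin m) ℝ,
      (p : MvPowerSeries (Fin m) ℝ) =
        ((VermaLorentzian.shiftedCharacter lam).monomialMul δ).normalize ∧
      VermaLorentzian.IsLorentzian p := by
  obtain ⟨hweight, h⟩ := mainTheorem8_general m lam
  exact ⟨fun μ _ => hweight μ, h⟩
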